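/- Let $n\ge 1$ be an integer and let $m\ge 0$ be real. Put $p_T(n,m)=1+\frac{2}{(m+1)(n-1)-m}$ if $n\ge 2$, $p_T(1,m)=+\infty$, and $\gamma_T(n,m;p)=2-[(m+1)(n-1)-m](p-1)$. Let $1<p<\infty$ with $p\le p_T(n,m)$. For $\varepsilon>0$ consider the Cauchy problem $$u_{tt}-t^{2m}\Delta u=|u_t|^p\ \text{ in } [0,T)\times\mathbb R^n,\qquad u(0,x)=\varepsilon f(x),\quad u_t(0,x)=\varepsilon g(x),$$ with real-valued $f\in H^1(\mathbb R^n)$ and $g\in H^{1-\frac1{m+1}}(\mathbb R^n)$, both supported in $\{|x|\le 1\}$. An energy solution on $[0,T)$, $0<T\le\infty$, is a function $u\in C([0,T),H^1(\mathbb R^n))\cap C^1([0,T),H^{1-\frac1{m+1}}(\mathbb R^n))$ with $u_t\in L^p_{\rm loc}((0,T)\times\mathbb R^n)$, $u(0,\cdot)=\varepsilon f$, $u_t(0,\cdot)=\varepsilon g$, such that for every $\Psi\in C^1_0([0,T)\times\mathbb R^n)\cap C^\infty((0,T)\times\mathbb R^n)$ the function $|u_t|^p\Psi$ is integrable on $(0,T)\times\mathbb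 R^n$ and $$\varepsilon\int_{\mathbb R^n} g\,\Psi(0,x)\,dx+\int_0^T\!\!\int_{\mathbb R^n}|u_t|^p\Psi\,dx\,dt=-\int_0^T\!\!\int_{\mathbb R^n}u_t\Psi_t\,dx\,dt+\int_0^T\!\!\int_{\mathbb R^n}t^{2m}\nabla u\cdot\nabla\Psi\,dx\,dt .$$ The lifespan $T_\varepsilon$ is the supremum of all $T\in(0,\infty]$ for which there is an energy solution on $[0,T)$ with $$\operatorname{supp}u\subset\Big\{(t,x)\in[0,T)\times\mathbb R^n:\ |x|\le 1+\tfrac{t^{m+1}}{m+1}\Big\}.$$ Assume that $a(m)f+g$ is non-negative and not identically zero (almost everywhere), where $$a(m)=[2(m+1)]^{\frac m{m+1}}\,\frac{\Gamma\big(\frac12+\frac m{2(m+1)}\big)}{\Gamma\big(\frac12-\frac m{2(m+1)}\big)} .$$ **Theorem.** There are constants $\varepsilon_0>0$ and $C>0$, depending only on $f,g,m,n,p$, such that for all $0<\varepsilon\le\varepsilon_0$ $$T_\varepsilon\le C\,\varepsilon^{-\frac{2(p-1)}{\gamma_T(n,m;p)}}\quad\text{if } p<p_T(n,m),\qquad T_\varepsilon\le\exp\big(C\varepsilon^{-(p-1)}\big)\quad\text{if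 } p=p_T(n,m).$$ In particular, every energy solution supported in this set blows up in finite time: none exists on $[0,T)$ with $T$ larger than these bounds. -/

import Mathlib

open MeasureTheory Set Filter Topology
open scoped ENNReal ContDiff SchwartzMap FourierTransform

noncomputable section

namespace Tricomi

/-- Euclidean space `ℝⁿ`. -/
abbrev E (n : ℕ) : Type := EuclideanSpace ℝ (Fin n)

/-- The real Hilbert space `L²(ℝⁿ)`, whose elements are a.e. classes of functions. -/
abbrev L2 (n : ℕ) : Type := Lp ℝ 2 (volume : Measure (E n))

variable {n : ℕ}

/-- A real `L²` function regarded as a complex-valued one. -/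
def toC (f : L2 n) : Lp ℂ 2 (volume : Measure (E n)) := Complex.ofRealCLM.compLp f

/-- `f ∈ Hˢ(ℝⁿ)`, for a function `f` in `L²` (so this is meant for `s ≥ 0`). -/
def InSobolev (s : ℝ) (f : L2 n) : Prop :=
  TemperedDistribution.MemSobolev s 2 (toC f : 𝓢'(E n, ℂ))

/-- The `Hˢ` norm `‖(1 + |ξ|²)^(s/2) f̂(ξ)‖_{L²}`, with the `L²` (Plancherel) Fourier transform;
it is infinite when `f ∉ Hˢ`. -/
def sobolevNorm (s : ℝ) (f : L2 n) : ℝ≥0∞ :=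
  eLpNorm (fun ξ : E n => (((1 + ‖ξ‖ ^ 2) ^ (s / 2) : ℝ) : ℂ) *
    (𝓕 (toC f) : Lp ℂ 2 (volume : Measure (E n))) ξ) 2 volume

/-- The half-open time interval `[0, T)`, where `0 < T ≤ ∞`. -/
def timeIco (T : ℝ≥0∞) : Set ℝ := {t | 0 ≤ t ∧ ENNReal.ofReal t < T}

/-- The open time interval `(0, T)`, where `0 < T ≤ ∞`. -/
def timeIoo (T : ℝ≥0∞) : Set ℝ := {t | 0 < t ∧ ENNReal.ofReal t < T}

/-- `u ∈ C([0, T), Hˢ(ℝⁿ))`. -/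
structure ContinuousInto (s : ℝ) (T : ℝ≥0∞) (u : ℝ → L2 n) : Prop where
  mem : ∀ t ∈ timeIco T, InSobolev s (u t)
  cont : ∀ t ∈ timeIco T,
    Tendsto (fun τ => sobolevNorm s (u τ - u t)) (𝓝[timeIco T] t) (𝓝 0)

/-- `v` is the derivative of the curve `u` on `[0, T)` in the norm of `Hˢ(ℝⁿ)`
(one-sided at `t = 0`). -/
def HasTimeDeriv (s : ℝ) (T : ℝ≥0∞) (u v : ℝ → L2 n) : Prop :=
  ∀ t ∈ timeIco T,
    Tendsto (fun τ => sobolevNorm s ((τ - t)⁻¹ • (u τ - u t) - v t))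
      (𝓝[timeIco T \ {t}] t) (𝓝 0)

/-- `G` is the distributional gradient of `f`. -/
def IsWeakGradient (f : L2 n) (G : Lp (E n) 2 (volume : Measure (E n))) : Prop :=
  ∀ φ : E n → ℝ, ContDiff ℝ ∞ φ → HasCompactSupport φ →
    ∫ x, f x • gradient φ x = - ∫ x, φ x • G x

/-- Test functions: `Ψ ∈ C¹₀([0, T) × ℝⁿ) ∩ C^∞((0, T) × ℝⁿ)`. The support may meet `t = 0`,
but it is a compact subset of `[0, T) × ℝⁿ`. -/
structure IsTestFunction (T : ℝ≥0∞) (Ψ : ℝ × E n → ℝ) : Prop where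
  c_one : ContDiffOn ℝ 1 Ψ (timeIco T ×ˢ univ)
  smooth : ContDiffOn ℝ ∞ Ψ (timeIoo T ×ˢ univ)
  compact_support : ∃ K : Set (ℝ × E n), IsCompact K ∧ K ⊆ timeIco T ×ˢ univ ∧
    ∀ z ∈ timeIco T ×ˢ univ, z ∉ K → Ψ z = 0

/-- `u` is an energy solution on `[0, T)` of `u_tt - t^(2m) Δu = |u_t|^p`, `u(0) = ε f`,
`u_t(0) = ε g`. The other data are determined by `u`: `v` is the time derivative as a curve in
`L²(ℝⁿ)`, `w` is the same derivative as a measurable function of `(t, x)`, and `G t` is the spatial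
gradient of `u t`. -/
structure IsEnergySolutionWith (m p ε : ℝ) (f g : L2 n) (T : ℝ≥0∞) (u v : ℝ → L2 n)
    (w : ℝ × E n → ℝ) (G : ℝ → Lp (E n) 2 (volume : Measure (E n))) : Prop where
  cont_u : ContinuousInto 1 T u
  cont_v : ContinuousInto (1 - 1 / (m + 1)) T v
  deriv_u : HasTimeDeriv (1 - 1 / (m + 1)) T u v
  grad_u : ∀ t ∈ timeIco T, IsWeakGradient (u t) (G t)
  rep_v : ∀ᵐ t ∂(volume.restrict (timeIoo T)), ∀ᵐ x : E n, w (t, x) = v t x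
  /-- `u_t ∈ L^p_loc((0, T) × ℝⁿ)` -/
  locLp : ∀ K : Set (ℝ × E n), IsCompact K → K ⊆ timeIoo T ×ˢ univ →
    MemLp w (ENNReal.ofReal p) (volume.restrict K)
  init_u : u 0 = ε • f
  init_v : v 0 = ε • g
  /-- the nonlinear term in the weak formulation is an honest (absolutely convergent) integral,
  also up to `t = 0` -/
  integrable : ∀ Ψ : ℝ × E n → ℝ, IsTestFunction T Ψ →
    IntegrableOn (fun z => |w z| ^ p * Ψ z) (timeIoo T ×ˢ univ)
  weak : ∀ Ψ : ℝ × E n → ℝ, IsTestFunction T Ψ →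
    ε * (∫ x, g x * Ψ (0, x)) + (∫ t in timeIoo T, ∫ x, |w (t, x)| ^ p * Ψ (t, x)) =
      (∫ t in timeIoo T, ∫ x, -(w (t, x)) * deriv (fun τ => Ψ (τ, x)) t) +
      ∫ t in timeIoo T, ∫ x, t ^ (2 * m) * inner ℝ (G t x) (gradient (fun y => Ψ (t, y)) x)

/-- `u` is an energy solution of the Cauchy problem on `[0, T)`. -/
def IsEnergySolution (m p ε : ℝ) (f g : L2 n) (T : ℝ≥0∞) (u : ℝ → L2 n) : Prop :=
  ∃ v w G, IsEnergySolutionWith m p ε f g T u v w G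

/-- `supp u ⊆ {(t, x) ∈ [0, T) × ℝⁿ : |x| ≤ 1 + t^(m+1)/(m+1)}`. -/
def SupportedInCone (m : ℝ) (T : ℝ≥0∞) (u : ℝ → L2 n) : Prop :=
  ∀ t ∈ timeIco T, ∀ᵐ x : E n, 1 + t ^ (m + 1) / (m + 1) < ‖x‖ → u t x = 0

/-- The lifespan `T_ε`: the supremum of all `T ∈ (0, ∞]` for which there is an energy solution
on `[0, T)` that is supported in the cone. -/
def lifespan (m p ε : ℝ) (f g : L2 n) : ℝ≥0∞ :=
  sSup {T : ℝ≥0∞ | 0 < T ∧ ∃ u : ℝ → L2 n,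
    IsEnergySolution m p ε f g T u ∧ SupportedInCone m T u}

/-- The exponent `p_T(n, m)`. -/
def pT (n : ℕ) (m : ℝ) : EReal :=
  if 2 ≤ n then ((1 + 2 / ((m + 1) * ((n : ℝ) - 1) - m) : ℝ) : EReal) else ⊤

/-- `γ_T(n, m; p)`. -/
def gammaT (n : ℕ) (m p : ℝ) : ℝ := 2 - ((m + 1) * ((n : ℝ) - 1) - m) * (p - 1)

/-- The constant `a(m)`. -/
def a (m : ℝ) : ℝ :=
  (2 * (m + 1)) ^ (m / (m + 1)) * Real.Gamma (1 / 2 + m / (2 * (m + 1))) *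
    (Real.Gamma (1 / 2 - m / (2 * (m + 1))))⁻¹

end Tricomi

end

/-!
# Finite lifespan for the semilinear generalized Tricomi equation with nonlinearity `|u_t| ^ p`

Everything happens for the two moments `U = ∫ u e^{x₁} dx` and `F = U' = ∫ u_t e^{x₁} dx` against
the plane wave `e^{x₁}`, a positive solution of `Δφ = φ`. Testing the weak formulation with
`η(t) e^{x₁}`, truncated outside the cone, gives `U'' = t ^ (2m) U + N` with
`N = ∫ |u_t| ^ p e^{x₁} dx ≥ 0` (`IsEnergySolutionWith.isForcedSol`). Hölder's inequality on the
cone yields `N ≥ F ^ p B ^ (-(p - 1))`, where `B` is the mass of the plane wave in the ball of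
radius `R = 1 + A`, `A = t ^ (m + 1) / (m + 1)`. A plane wave suffices in place of its spherical
mean, because `∫_{|x| ≤ R} e^{x₁} dx` already has the growth `R ^ ((n - 1) / 2) e ^ R`
(`setIntegral_exp_le`).

Let `λ > 0` be the decaying solution of `λ'' = t ^ (2m) λ`, a Bessel function, for which
`-λ' 0 / λ 0 = a(m)` (`decaySolDeriv_zero`). The Wronskian `W = F λ - U λ'` satisfies `W' = N λ`,
and `W 0 = ε λ 0 ∫ (a(m) f + g) e^{x₁} dx > 0`. With the growing solution `μ = λ ∫ λ⁻²` one has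
`F ≥ W μ' - O(ε)`, so `F ≥ W μ' / 2` from a time independent of `ε` on
(`IsForcedSol.deriv_lower_bound`). Hence `W' ≥ λ (μ' / 2) ^ p B ^ (-(p - 1)) W ^ p`. As `λ μ'` is
bounded below and `μ'` grows at least like `t ^ (m / 2) e ^ A`, the exponentials cancel and
`W' ≥ c t ^ (γ / 2 - 1) W ^ p` (`exists_rate`). Integrating this inequality up to any time `b` of
existence gives `∫ t ^ (γ / 2 - 1) dt ≤ K ε ^ (-(p - 1))`, a power bound for `b` when `γ > 0` and an
exponential one when `γ = 0`.

The growth of `λ` and `μ` is obtained from monotone quantities and Riccati comparison, without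
asymptotic expansions of Bessel functions.
-/

/-! ### The decaying solution of `λ'' = t ^ (2m) λ` -/

namespace Tricomi

/-- The integral `∫₀^∞ exp (-σ - c / σ) σ ^ (s - 1) dσ`, which equals `2 c ^ (s / 2) K_s (2 √c)` with
`K_s` the Macdonald function. -/
noncomputable def macdonaldIntegral (s c : ℝ) : ℝ :=
  ∫ σ in Ioi (0 : ℝ), Real.exp (-σ - c / σ) * σ ^ (s - 1)

lemma continuousOn_macdonaldIntegrand (s c : ℝ) :
    ContinuousOn (fun σ : ℝ => Real.exp (-σ - c / σ) * σ ^ (s - 1)) (Ioi 0) := by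
  intro σ hσ
  have h0 : σ ≠ 0 := (mem_Ioi.1 hσ).ne'
  refine ContinuousAt.continuousWithinAt ?_
  refine ContinuousAt.mul ?_ (Real.continuousAt_rpow_const _ _ (Or.inl h0))
  exact (continuousAt_id.neg.sub (continuousAt_const.div continuousAt_id h0)).rexp

lemma aestronglyMeasurable_macdonaldIntegrand (s c : ℝ) :
    AEStronglyMeasurable (fun σ : ℝ => Real.exp (-σ - c / σ) * σ ^ (s - 1))
      (volume.restrict (Ioi 0)) :=
  (continuousOn_macdonaldIntegrand s c).aestronglyMeasurable measurableSet_Ioi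

lemma macdonaldIntegrand_nonneg (s c : ℝ) {σ : ℝ} (hσ : 0 < σ) :
    0 ≤ Real.exp (-σ - c / σ) * σ ^ (s - 1) := by positivity

lemma macdonaldIntegrand_le (s : ℝ) {c σ : ℝ} (hc : 0 ≤ c) (hσ : 0 < σ) :
    Real.exp (-σ - c / σ) * σ ^ (s - 1) ≤ Real.exp (-σ) * σ ^ (s - 1) := by
  have : 0 ≤ c / σ := by positivity
  gcongr
  linarith

/-- For `c > 0` the factor `exp (-c / σ)` gains one power of `σ` at the origin. -/
lemma macdonaldIntegrand_le_div (s : ℝ) {c σ : ℝ} (hc : 0 < c) (hσ : 0 < σ) :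
    Real.exp (-σ - c / σ) * σ ^ (s - 1) ≤ c⁻¹ * (Real.exp (-σ) * σ ^ (s + 1 - 1)) := by
  have h1 : Real.exp (-(c / σ)) ≤ σ / c := by
    rw [Real.exp_neg, ← inv_div c σ]
    have h2 : (0 : ℝ) < c / σ := by positivity
    exact inv_anti₀ h2 (by linarith [Real.add_one_le_exp (c / σ)])
  have h2 : σ ^ (s + 1 - 1) = σ * σ ^ (s - 1) := by
    rw [show s + 1 - 1 = 1 + (s - 1) by ring, Real.rpow_add hσ, Real.rpow_one]
  have h3 : (0 : ℝ) < σ ^ (s - 1) := by positivity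
  calc Real.exp (-σ - c / σ) * σ ^ (s - 1)
      = Real.exp (-(c / σ)) * (Real.exp (-σ) * σ ^ (s - 1)) := by
        rw [sub_eq_add_neg, Real.exp_add]; ring
    _ ≤ σ / c * (Real.exp (-σ) * σ ^ (s - 1)) := by gcongr
    _ = _ := by rw [h2]; field_simp

lemma integrableOn_macdonald {s c : ℝ} (hs : 0 < s) (hc : 0 ≤ c) :
    IntegrableOn (fun σ : ℝ => Real.exp (-σ - c / σ) * σ ^ (s - 1)) (Ioi 0) := by
  refine (Real.GammaIntegral_convergent hs).mono' (aestronglyMeasurable_macdonaldIntegrand s c) ?_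
  filter_upwards [ae_restrict_mem measurableSet_Ioi] with σ hσ
  rw [Real.norm_of_nonneg (macdonaldIntegrand_nonneg s c hσ)]
  exact macdonaldIntegrand_le s hc hσ

lemma continuousOn_macdonaldIntegral {s : ℝ} (hs : 0 < s) :
    ContinuousOn (macdonaldIntegral s) (Ici 0) := by
  refine continuousOn_of_dominated (bound := fun σ => Real.exp (-σ) * σ ^ (s - 1))
    (fun c _ => aestronglyMeasurable_macdonaldIntegrand s c) ?_
    (Real.GammaIntegral_convergent hs) ?_
  · intro c hc
    filter_upwards [ae_restrict_mem measurableSet_Ioi] with σ hσ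
    rw [Real.norm_of_nonneg (macdonaldIntegrand_nonneg s c hσ)]
    exact macdonaldIntegrand_le s hc hσ
  · refine Eventually.of_forall fun σ => Continuous.continuousOn ?_
    fun_prop

lemma macdonaldIntegral_zero {s : ℝ} (hs : 0 < s) : macdonaldIntegral s 0 = Real.Gamma s := by
  simp [macdonaldIntegral, Real.Gamma_eq_integral hs]

lemma macdonaldIntegral_pos {s c : ℝ} (hs : 0 < s) (hc : 0 ≤ c) : 0 < macdonaldIntegral s c := by
  refine (setIntegral_pos_iff_support_of_nonneg_ae ?_ (integrableOn_macdonald hs hc)).2 ?_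
  · filter_upwards [ae_restrict_mem measurableSet_Ioi] with σ hσ
    exact macdonaldIntegrand_nonneg s c hσ
  · have : Function.support (fun σ : ℝ => Real.exp (-σ - c / σ) * σ ^ (s - 1)) ∩ Ioi 0 = Ioi 0 := by
      refine inter_eq_right.2 fun σ hσ => ?_
      have : (0 : ℝ) < σ := hσ
      exact (by positivity : (0 : ℝ) < Real.exp (-σ - c / σ) * σ ^ (s - 1)).ne'
    rw [this]
    simp

lemma hasDerivAt_macdonaldIntegral {s c : ℝ} (hs : 0 < s) (hc : 0 < c) :
    HasDerivAt (macdonaldIntegral s) (-macdonaldIntegral (s - 1) c) c := by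
  have key := hasDerivAt_integral_of_dominated_loc_of_deriv_le
    (μ := volume.restrict (Ioi (0 : ℝ)))
    (F := fun c σ => Real.exp (-σ - c / σ) * σ ^ (s - 1))
    (F' := fun c σ => -(Real.exp (-σ - c / σ) * σ ^ (s - 1 - 1)))
    (bound := fun σ => (c / 2)⁻¹ * (Real.exp (-σ) * σ ^ (s - 1)))
    (s := Ioi (c / 2)) (x₀ := c) (Ioi_mem_nhds (by linarith))
    (Eventually.of_forall fun c => aestronglyMeasurable_macdonaldIntegrand s c)
    (integrableOn_macdonald hs hc.le) (aestronglyMeasurable_macdonaldIntegrand (s - 1) c).neg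
    ?_ ((Real.GammaIntegral_convergent hs).const_mul _) ?_
  · have := key.2
    rwa [integral_neg] at this
  · filter_upwards [ae_restrict_mem measurableSet_Ioi] with σ hσ x hx
    have hx' : c / 2 < x := hx
    have hσ' : (0 : ℝ) < σ := hσ
    rw [norm_neg, Real.norm_of_nonneg (macdonaldIntegrand_nonneg (s - 1) x hσ)]
    refine (macdonaldIntegrand_le_div (s - 1) (by linarith) hσ).trans ?_
    rw [sub_add_cancel]
    gcongr
  · filter_upwards [ae_restrict_mem measurableSet_Ioi] with σ hσ x hx
    have hσ' : (0 : ℝ) < σ := hσ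
    have h1 : HasDerivAt (fun x : ℝ => -σ - x / σ) (-(1 / σ)) x := by
      simpa using ((hasDerivAt_id x).div_const σ).const_sub (-σ)
    refine (h1.exp.mul_const (σ ^ (s - 1))).congr_deriv ?_
    rw [show σ ^ (s - 1) = σ * σ ^ (s - 1 - 1) by
      rw [Real.rpow_sub_one hσ'.ne' (s - 1)]; field_simp]
    field_simp

/-- The reflection `K_{-s} = K_s`, by the substitution `σ ↦ c / σ`. -/
lemma macdonaldIntegral_neg (s : ℝ) {c : ℝ} (hc : 0 < c) :
    macdonaldIntegral (-s) c = c ^ (-s) * macdonaldIntegral s c := by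
  unfold macdonaldIntegral
  rw [← integral_comp_rpow_Ioi (fun σ : ℝ => Real.exp (-σ - c / σ) * σ ^ (s - 1))
    (p := -1) (by norm_num), ← integral_const_mul]
  have h := integral_comp_mul_left_Ioi
    (fun σ : ℝ => c ^ (-s) * ((|(-1 : ℝ)| * σ ^ ((-1 : ℝ) - 1)) •
      (Real.exp (-σ ^ (-1 : ℝ) - c / σ ^ (-1 : ℝ)) * (σ ^ (-1 : ℝ)) ^ (s - 1)))) 0
    (inv_pos.2 hc)
  rw [mul_zero, inv_inv, smul_eq_mul, ← inv_mul_eq_iff_eq_mul₀ hc.ne', ← integral_const_mul] at h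
  rw [← h]
  refine setIntegral_congr_fun measurableSet_Ioi fun x hx => ?_
  have hx' : (0 : ℝ) < x := hx
  have e1 : (c⁻¹ * x) ^ (-1 : ℝ) = c * x⁻¹ := by
    rw [Real.rpow_neg_one, mul_inv, inv_inv]
  have e2 : (c⁻¹ * x) ^ ((-1 : ℝ) - 1) = c ^ (2 : ℝ) * x ^ (-2 : ℝ) := by
    rw [Real.mul_rpow (by positivity) hx'.le, Real.inv_rpow hc.le, ← Real.rpow_neg hc.le]
    norm_num
  have e3 : (c * x⁻¹) ^ (s - 1) = c ^ (s - 1) * x ^ (1 - s) := by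
    rw [Real.mul_rpow hc.le (by positivity), Real.inv_rpow hx'.le, ← Real.rpow_neg hx'.le]
    ring_nf
  have e4 : -(c * x⁻¹) - c / (c * x⁻¹) = -x - c / x := by field_simp; ring
  have e5 : c⁻¹ * c ^ (-s) * c ^ (2 : ℝ) * c ^ (s - 1) = 1 := by
    rw [← Real.rpow_neg_one, ← Real.rpow_add hc, ← Real.rpow_add hc, ← Real.rpow_add hc]
    ring_nf
    simp
  have e6 : x ^ (-2 : ℝ) * x ^ (1 - s) = x ^ (-s - 1) := by
    rw [← Real.rpow_add hx']
    ring_nf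
  simp only [e1, e2, e3, e4, smul_eq_mul, abs_neg, abs_one, one_mul]
  rw [← e6]
  linear_combination (-(Real.exp (-x - c / x) * (x ^ (-2 : ℝ) * x ^ (1 - s)))) * e5

/-- The decaying solution `√t K_ν (t ^ (m + 1) / (m + 1))`, `ν = 1 / (2 (m + 1))`, of
`λ'' = t ^ (2m) λ`, up to a constant factor. -/
noncomputable def decaySol (m t : ℝ) : ℝ :=
  macdonaldIntegral (1 / (2 * (m + 1))) ((1 / (2 * (m + 1))) ^ (2 : ℝ) * t ^ (2 * m + 2))

/-- The derivative of `decaySol m`; see `hasDerivAt_decaySol`. -/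
noncomputable def decaySolDeriv (m t : ℝ) : ℝ :=
  -((1 / (2 * (m + 1))) ^ (2 * (1 / (2 * (m + 1))) - 1) * macdonaldIntegral (1 - 1 / (2 * (m + 1)))
    ((1 / (2 * (m + 1))) ^ (2 : ℝ) * t ^ (2 * m + 2)))

section DecaySol

variable {m : ℝ}

lemma decay_index_pos (hm : 0 ≤ m) : 0 < 1 / (2 * (m + 1)) := by positivity

lemma decay_index_lt (hm : 0 ≤ m) : 0 < 1 - 1 / (2 * (m + 1)) := by
  rw [sub_pos, div_lt_one (by positivity)]
  linarith

lemma decaySol_pos (hm : 0 ≤ m) {t : ℝ} (ht : 0 ≤ t) : 0 < decaySol m t :=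
  macdonaldIntegral_pos (decay_index_pos hm) (by positivity)

lemma decaySolDeriv_neg (hm : 0 ≤ m) {t : ℝ} (ht : 0 ≤ t) : decaySolDeriv m t < 0 := by
  have h := decay_index_pos hm
  have := macdonaldIntegral_pos (decay_index_lt hm)
    (c := (1 / (2 * (m + 1))) ^ (2 : ℝ) * t ^ (2 * m + 2)) (by positivity)
  unfold decaySolDeriv
  rw [neg_lt_zero]
  positivity

lemma continuousOn_decay_argument (hm : 0 ≤ m) (c : ℝ) :
    ContinuousOn (fun t : ℝ => c * t ^ (2 * m + 2)) (Ici 0) :=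
  ((Real.continuous_rpow_const (by positivity)).const_mul c).continuousOn

lemma mapsTo_decay_argument (hm : 0 ≤ m) :
    MapsTo (fun t : ℝ => (1 / (2 * (m + 1))) ^ (2 : ℝ) * t ^ (2 * m + 2)) (Ici 0) (Ici 0) := by
  intro t ht
  have : (0 : ℝ) ≤ t := ht
  simp only [mem_Ici]
  positivity

lemma continuousOn_decaySol (hm : 0 ≤ m) : ContinuousOn (decaySol m) (Ici 0) :=
  (continuousOn_macdonaldIntegral (decay_index_pos hm)).comp
    (continuousOn_decay_argument hm _) (mapsTo_decay_argument hm)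

lemma continuousOn_decaySolDeriv (hm : 0 ≤ m) : ContinuousOn (decaySolDeriv m) (Ici 0) :=
  (((continuousOn_macdonaldIntegral (decay_index_lt hm)).comp
    (continuousOn_decay_argument hm _) (mapsTo_decay_argument hm)).const_mul _).neg

lemma hasDerivAt_decay_argument (ν : ℝ) {t : ℝ} (ht : 0 < t) :
    HasDerivAt (fun t : ℝ => ν ^ (2 : ℝ) * t ^ (2 * m + 2))
      (ν ^ (2 : ℝ) * ((2 * m + 2) * t ^ (2 * m + 1))) t := by
  have := (Real.hasDerivAt_rpow_const (p := 2 * m + 2) (Or.inl ht.ne')).const_mul (ν ^ (2 : ℝ))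
  rwa [show 2 * m + 2 - 1 = 2 * m + 1 by ring] at this

lemma hasDerivAt_decaySol (hm : 0 ≤ m) {t : ℝ} (ht : 0 < t) :
    HasDerivAt (decaySol m) (decaySolDeriv m t) t := by
  have hν := decay_index_pos hm
  unfold decaySol decaySolDeriv
  have hmν : (2 * m + 2) = (1 / (2 * (m + 1)))⁻¹ := by field_simp
  set ν := 1 / (2 * (m + 1)) with hνdef
  have hq : 0 < ν ^ (2 : ℝ) * t ^ (2 * m + 2) := by positivity
  refine ((hasDerivAt_macdonaldIntegral hν hq).comp t
    (hasDerivAt_decay_argument ν ht)).congr_deriv ?_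
  rw [show ν - 1 = -(1 - ν) by ring, macdonaldIntegral_neg _ hq,
    Real.mul_rpow (by positivity) (by positivity), ← Real.rpow_mul hν.le, ← Real.rpow_mul ht.le]
  have e1 : t ^ ((2 * m + 2) * -(1 - ν)) * t ^ (2 * m + 1) = 1 := by
    rw [← Real.rpow_add ht]
    have : (2 * m + 2) * ν = 1 := by rw [hmν]; field_simp
    rw [show (2 * m + 2) * -(1 - ν) + (2 * m + 1) = 0 by linear_combination this]
    simp
  have e2 : ν ^ ((2 : ℝ) * -(1 - ν)) * ν ^ (2 : ℝ) * (2 * m + 2) = ν ^ (2 * ν - 1) := by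
    rw [hmν, ← Real.rpow_neg_one, ← Real.rpow_add hν, ← Real.rpow_add hν]
    ring_nf
  rw [← e2]
  linear_combination (-(ν ^ ((2 : ℝ) * -(1 - ν)) * ν ^ (2 : ℝ) * (2 * m + 2) *
    macdonaldIntegral (1 - ν) (ν ^ (2 : ℝ) * t ^ (2 * m + 2)))) * e1

lemma hasDerivAt_decaySolDeriv (hm : 0 ≤ m) {t : ℝ} (ht : 0 < t) :
    HasDerivAt (decaySolDeriv m) (t ^ (2 * m) * decaySol m t) t := by
  have hν := decay_index_pos hm
  have hν1 := decay_index_lt hm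
  unfold decaySol decaySolDeriv
  have hmν : (2 * m + 2) = (1 / (2 * (m + 1)))⁻¹ := by field_simp
  set ν := 1 / (2 * (m + 1)) with hνdef
  have hq : 0 < ν ^ (2 : ℝ) * t ^ (2 * m + 2) := by positivity
  refine (((hasDerivAt_macdonaldIntegral hν1 hq).comp t
    (hasDerivAt_decay_argument ν ht)).const_mul (ν ^ (2 * ν - 1))).neg.congr_deriv ?_
  rw [show 1 - ν - 1 = -ν by ring, macdonaldIntegral_neg _ hq,
    Real.mul_rpow (by positivity) (by positivity), ← Real.rpow_mul hν.le, ← Real.rpow_mul ht.le]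
  have e1 : t ^ ((2 * m + 2) * -ν) * t ^ (2 * m + 1) = t ^ (2 * m) := by
    rw [← Real.rpow_add ht]
    have : (2 * m + 2) * ν = 1 := by rw [hmν]; field_simp
    rw [show (2 * m + 2) * -ν + (2 * m + 1) = 2 * m by linear_combination -this]
  have e2 : ν ^ (2 * ν - 1) * ν ^ ((2 : ℝ) * -ν) * ν ^ (2 : ℝ) * (2 * m + 2) = 1 := by
    rw [hmν, ← Real.rpow_neg_one, ← Real.rpow_add hν, ← Real.rpow_add hν, ← Real.rpow_add hν]
    ring_nf
    simp
  rw [← e1]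
  linear_combination (t ^ ((2 * m + 2) * -ν) * t ^ (2 * m + 1) *
    macdonaldIntegral ν (ν ^ (2 : ℝ) * t ^ (2 * m + 2))) * e2

/-- The constant `a m` is minus the logarithmic derivative of the decaying solution at `0`. -/
lemma decaySolDeriv_zero (hm : 0 ≤ m) : decaySolDeriv m 0 = -(a m * decaySol m 0) := by
  have hν := decay_index_pos hm
  have hν1 := decay_index_lt hm
  unfold decaySol decaySolDeriv a
  have e0 : (0 : ℝ) ^ (2 * m + 2) = 0 := Real.zero_rpow (by positivity)
  have e1 : 1 / 2 + m / (2 * (m + 1)) = 1 - 1 / (2 * (m + 1)) := by field_simp; ring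
  have e2 : 1 / 2 - m / (2 * (m + 1)) = 1 / (2 * (m + 1)) := by field_simp; ring
  have e3 : 2 * (1 / (2 * (m + 1))) - 1 = -(m / (m + 1)) := by field_simp; ring
  have e4 : (2 * (m + 1)) = (1 / (2 * (m + 1)))⁻¹ := by field_simp
  rw [e0, mul_zero, macdonaldIntegral_zero hν, macdonaldIntegral_zero hν1, e1, e2, e3]
  have hΓ := Real.Gamma_pos_of_pos hν
  have e5 : (2 * (m + 1)) ^ (m / (m + 1)) = (1 / (2 * (m + 1))) ^ (-(m / (m + 1))) := by
    rw [Real.rpow_neg hν.le, ← Real.inv_rpow hν.le, ← e4]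
  rw [← e5, neg_inj, mul_assoc, mul_assoc, inv_mul_cancel₀ hΓ.ne', mul_one]

end DecaySol

end Tricomi

/-! ### The growing solution of `μ'' = t ^ (2m) μ` and its rate of growth -/

namespace Tricomi

/-- The phase `A(t) = t ^ (m + 1) / (m + 1)`; the cone at time `t` is the ball of radius
`1 + A(t)`. -/
noncomputable def phase (m t : ℝ) : ℝ := t ^ (m + 1) / (m + 1)

/-- The primitive `∫₀ᵗ λ⁻²` of the decaying solution `λ`. -/
noncomputable def invSqIntegral (m t : ℝ) : ℝ := ∫ s in (0 : ℝ)..t, (decaySol m s ^ 2)⁻¹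

/-- The solution `μ = λ ∫₀ᵗ λ⁻²` with `μ 0 = 0` and Wronskian `λ μ' - λ' μ = 1`. -/
noncomputable def growSol (m t : ℝ) : ℝ := decaySol m t * invSqIntegral m t

/-- The derivative of `growSol m`; see `hasDerivAt_growSol`. -/
noncomputable def growSolDeriv (m t : ℝ) : ℝ :=
  (decaySol m t)⁻¹ + decaySolDeriv m t * invSqIntegral m t

lemma monotoneOn_Ici_of_hasDerivAt {f f' : ℝ → ℝ} {b : ℝ} (hc : ContinuousOn f (Ici b))
    (h : ∀ t, b < t → HasDerivAt f (f' t) t) (h0 : ∀ t, b < t → 0 ≤ f' t) :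
    MonotoneOn f (Ici b) := by
  refine monotoneOn_of_hasDerivWithinAt_nonneg (f' := f') (convex_Ici b) hc ?_ ?_
  · intro t ht
    rw [interior_Ici, mem_Ioi] at ht
    exact (h t ht).hasDerivWithinAt
  · intro t ht
    rw [interior_Ici, mem_Ioi] at ht
    exact h0 t ht

variable {m : ℝ}

lemma phase_nonneg (hm : 0 ≤ m) {t : ℝ} (ht : 0 ≤ t) : 0 ≤ phase m t := by
  unfold phase; positivity

lemma phase_mono (hm : 0 ≤ m) {s t : ℝ} (hs : 0 ≤ s) (h : s ≤ t) : phase m s ≤ phase m t := by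
  unfold phase; gcongr

lemma hasDerivAt_phase (hm : 0 ≤ m) {t : ℝ} (ht : 0 < t) : HasDerivAt (phase m) (t ^ m) t := by
  have := (Real.hasDerivAt_rpow_const (p := m + 1) (Or.inl ht.ne')).div_const (m + 1)
  refine this.congr_deriv ?_
  have : m + 1 ≠ 0 := by positivity
  rw [add_sub_cancel_right]
  field_simp

lemma tendsto_phase (hm : 0 ≤ m) : Tendsto (phase m) atTop atTop :=
  (tendsto_rpow_atTop (by positivity)).atTop_div_const (by positivity)

lemma continuousOn_inv_decaySol_sq (hm : 0 ≤ m) :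
    ContinuousOn (fun s => (decaySol m s ^ 2)⁻¹) (Ici 0) :=
  ((continuousOn_decaySol hm).pow 2).inv₀ fun _ ht => (pow_pos (decaySol_pos hm ht) 2).ne'

lemma intervalIntegrable_inv_decaySol_sq (hm : 0 ≤ m) {s t : ℝ} (hs : 0 ≤ s) (ht : 0 ≤ t) :
    IntervalIntegrable (fun s => (decaySol m s ^ 2)⁻¹) volume s t :=
  ((continuousOn_inv_decaySol_sq hm).mono fun _ hx =>
    le_trans (le_min hs ht) hx.1).intervalIntegrable

lemma hasDerivAt_invSqIntegral (hm : 0 ≤ m) {t : ℝ} (ht : 0 < t) :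
    HasDerivAt (invSqIntegral m) (decaySol m t ^ 2)⁻¹ t :=
  intervalIntegral.integral_hasDerivAt_right
    (intervalIntegrable_inv_decaySol_sq hm le_rfl ht.le)
    (((continuousOn_inv_decaySol_sq hm).mono Ioi_subset_Ici_self).stronglyMeasurableAtFilter
      isOpen_Ioi t ht)
    ((continuousOn_inv_decaySol_sq hm).continuousAt (Ici_mem_nhds ht))

lemma continuousOn_invSqIntegral (hm : 0 ≤ m) : ContinuousOn (invSqIntegral m) (Ici 0) := by
  intro t ht
  have ht0 : (0 : ℝ) ≤ t := ht
  have h := intervalIntegral.continuousOn_primitive_interval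
    (μ := volume) (f := fun s => (decaySol m s ^ 2)⁻¹) (a := 0) (b := t + 1)
    ((intervalIntegrable_iff' ).1
      (intervalIntegrable_inv_decaySol_sq hm le_rfl (by linarith : (0 : ℝ) ≤ t + 1)))
  rw [uIcc_of_le (by linarith)] at h
  refine (h t ⟨ht0, by linarith⟩).mono_of_mem_nhdsWithin ?_
  rw [← Ici_inter_Iic]
  exact inter_mem_nhdsWithin _ (Iic_mem_nhds (by linarith))

lemma invSqIntegral_zero : invSqIntegral m 0 = 0 := by simp [invSqIntegral]

lemma invSqIntegral_monotoneOn (hm : 0 ≤ m) : MonotoneOn (invSqIntegral m) (Ici 0) :=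
  monotoneOn_Ici_of_hasDerivAt (continuousOn_invSqIntegral hm)
    (fun _ ht => hasDerivAt_invSqIntegral hm ht) fun _ _ => by positivity

lemma invSqIntegral_nonneg (hm : 0 ≤ m) {t : ℝ} (ht : 0 ≤ t) : 0 ≤ invSqIntegral m t := by
  have := invSqIntegral_monotoneOn hm (mem_Ici.2 le_rfl) ht ht
  rwa [invSqIntegral_zero] at this

lemma growSol_nonneg (hm : 0 ≤ m) {t : ℝ} (ht : 0 ≤ t) : 0 ≤ growSol m t :=
  mul_nonneg (decaySol_pos hm ht).le (invSqIntegral_nonneg hm ht)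

lemma wronskian_growSol (hm : 0 ≤ m) {t : ℝ} (ht : 0 ≤ t) :
    decaySol m t * growSolDeriv m t - decaySolDeriv m t * growSol m t = 1 := by
  have := (decaySol_pos hm ht).ne'
  unfold growSol growSolDeriv
  field_simp
  ring

lemma hasDerivAt_growSol (hm : 0 ≤ m) {t : ℝ} (ht : 0 < t) :
    HasDerivAt (growSol m) (growSolDeriv m t) t := by
  have h0 := (decaySol_pos hm ht.le).ne'
  refine ((hasDerivAt_decaySol hm ht).mul (hasDerivAt_invSqIntegral hm ht)).congr_deriv ?_
  unfold growSolDeriv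
  field_simp
  ring

lemma hasDerivAt_growSolDeriv (hm : 0 ≤ m) {t : ℝ} (ht : 0 < t) :
    HasDerivAt (growSolDeriv m) (t ^ (2 * m) * growSol m t) t := by
  have h0 := (decaySol_pos hm ht.le).ne'
  refine (((hasDerivAt_decaySol hm ht).inv h0).add
    ((hasDerivAt_decaySolDeriv hm ht).mul (hasDerivAt_invSqIntegral hm ht))).congr_deriv ?_
  unfold growSol
  field_simp
  ring

lemma continuousOn_growSolDeriv (hm : 0 ≤ m) : ContinuousOn (growSolDeriv m) (Ici 0) :=
  ((continuousOn_decaySol hm).inv₀ fun _ ht => (decaySol_pos hm ht).ne').add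
    ((continuousOn_decaySolDeriv hm).mul (continuousOn_invSqIntegral hm))

lemma growSolDeriv_pos (hm : 0 ≤ m) {t : ℝ} (ht : 0 ≤ t) : 0 < growSolDeriv m t := by
  have h := monotoneOn_Ici_of_hasDerivAt (continuousOn_growSolDeriv hm)
    (fun _ ht => hasDerivAt_growSolDeriv hm ht)
    (fun t ht => mul_nonneg (by positivity) (growSol_nonneg hm ht.le)) (mem_Ici.2 le_rfl) ht ht
  refine lt_of_lt_of_le ?_ h
  have := decaySol_pos hm le_rfl
  simp only [growSolDeriv, invSqIntegral_zero, mul_zero, add_zero]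
  positivity

lemma growSol_pos (hm : 0 ≤ m) {t : ℝ} (ht : 0 < t) : 0 < growSol m t := by
  refine mul_pos (decaySol_pos hm ht.le) (intervalIntegral.intervalIntegral_pos_of_pos_on
    (intervalIntegrable_inv_decaySol_sq hm le_rfl ht.le) (fun s hs => ?_) ht)
  have := decaySol_pos hm hs.1.le
  positivity

/-- Riccati comparison: `c t ^ m` is a lower barrier for `μ' / μ`. -/
lemma exists_mul_growSol_le (hm : 0 ≤ m) :
    ∃ c : ℝ, 0 < c ∧ ∀ t, 1 ≤ t → c * (t ^ m * growSol m t) ≤ growSolDeriv m t := by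
  have hM1 := growSolDeriv_pos hm zero_le_one
  have hμ1 := growSol_nonneg hm zero_le_one
  obtain ⟨c, hc0, hc1, hc2⟩ : ∃ c : ℝ, 0 < c ∧ c ≤ 1 / (m + 1) ∧
      c * growSol m 1 ≤ growSolDeriv m 1 := by
    refine ⟨min (1 / (m + 1)) (growSolDeriv m 1 / (growSol m 1 + 1)), ?_, min_le_left _ _, ?_⟩
    · exact lt_min (by positivity) (by positivity)
    · calc _ ≤ growSolDeriv m 1 / (growSol m 1 + 1) * (growSol m 1 + 1) :=
            mul_le_mul (min_le_right _ _) (by linarith) hμ1 (by positivity)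
        _ = _ := by field_simp
  refine ⟨c, hc0, ?_⟩
  have hD : ∀ t, 0 < t → HasDerivAt
      (fun t => Real.exp (c * phase m t) * (growSolDeriv m t - c * (t ^ m * growSol m t)))
      (Real.exp (c * phase m t) * (t ^ (2 * m) * growSol m t * (1 - c ^ 2) -
        c * (m * t ^ (m - 1) * growSol m t))) t := by
    intro t ht
    have h1 := ((hasDerivAt_phase hm ht).const_mul c).exp
    have h2 := (Real.hasDerivAt_rpow_const (p := m) (Or.inl ht.ne')).mul (hasDerivAt_growSol hm ht)
    refine (h1.mul ((hasDerivAt_growSolDeriv hm ht).sub (h2.const_mul c))).congr_deriv ?_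
    have h3 : t ^ (2 * m) = t ^ m * t ^ m := by rw [← Real.rpow_add ht]; ring_nf
    simp only [Pi.sub_apply, Pi.mul_apply, h3]
    ring
  have hmono := monotoneOn_Ici_of_hasDerivAt (b := 1)
    (fun t ht => (hD t (lt_of_lt_of_le one_pos ht)).continuousAt.continuousWithinAt)
    (fun t ht => hD t (one_pos.trans ht)) ?_
  · intro t ht
    have h1 := hmono (mem_Ici.2 le_rfl) ht ht
    have h2 : 0 ≤ Real.exp (c * phase m 1) *
        (growSolDeriv m 1 - c * ((1 : ℝ) ^ m * growSol m 1)) := by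
      rw [Real.one_rpow, one_mul]
      exact mul_nonneg (Real.exp_pos _).le (by linarith)
    have h3 := nonneg_of_mul_nonneg_right (h2.trans h1) (Real.exp_pos _)
    linarith
  · intro t ht
    have ht0 : 0 < t := one_pos.trans ht
    have h1 : t ^ (m - 1) ≤ t ^ (2 * m) := Real.rpow_le_rpow_of_exponent_le ht.le (by linarith)
    have h2 : 0 ≤ growSol m t := growSol_nonneg hm ht0.le
    have h3 : 0 < t ^ (2 * m) := by positivity
    have h4 : c * (m + 1) ≤ 1 := by rwa [le_div_iff₀ (by positivity)] at hc1
    have h5 : c * m ≤ 1 - c ^ 2 := by nlinarith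
    refine mul_nonneg (Real.exp_pos _).le ?_
    have h6 : c * m * t ^ (m - 1) ≤ (1 - c ^ 2) * t ^ (2 * m) := by
      calc _ ≤ c * m * t ^ (2 * m) := by gcongr
        _ ≤ _ := by gcongr
    nlinarith [mul_le_mul_of_nonneg_right h6 h2]

/-- `(μ μ')' = μ' ^ 2 + t ^ (2m) μ ^ 2 ≥ 2 t ^ m μ μ'`, so `exp (-2 A) μ μ'` is non-decreasing. -/
lemma exists_exp_le_growSol_mul (hm : 0 ≤ m) :
    ∃ c : ℝ, 0 < c ∧ ∀ t, 1 ≤ t →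
      c * Real.exp (2 * phase m t) ≤ growSol m t * growSolDeriv m t := by
  have hD : ∀ t, 0 < t → HasDerivAt
      (fun t => Real.exp (-2 * phase m t) * (growSol m t * growSolDeriv m t))
      (Real.exp (-2 * phase m t) * (growSolDeriv m t - t ^ m * growSol m t) ^ 2) t := by
    intro t ht
    have h1 := ((hasDerivAt_phase hm ht).const_mul (-2)).exp
    refine (h1.mul ((hasDerivAt_growSol hm ht).mul (hasDerivAt_growSolDeriv hm ht))).congr_deriv ?_
    have h3 : t ^ (2 * m) = t ^ m * t ^ m := by rw [← Real.rpow_add ht]; ring_nf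
    simp only [Pi.mul_apply, h3]
    ring
  have hmono := monotoneOn_Ici_of_hasDerivAt (b := 1)
    (fun t ht => (hD t (lt_of_lt_of_le one_pos ht)).continuousAt.continuousWithinAt)
    (fun t ht => hD t (one_pos.trans ht)) (fun t _ => by positivity)
  have hμ := growSol_pos hm one_pos
  have hM := growSolDeriv_pos hm zero_le_one
  refine ⟨Real.exp (-2 * phase m 1) * (growSol m 1 * growSolDeriv m 1), by positivity, ?_⟩
  intro t ht
  have h1 := hmono (mem_Ici.2 le_rfl) ht ht
  calc _ ≤ Real.exp (-2 * phase m t) * (growSol m t * growSolDeriv m t) *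
        Real.exp (2 * phase m t) := by
        gcongr
    _ = _ := by
        rw [mul_comm, ← mul_assoc, ← Real.exp_add]
        simp

/-- The logarithmic derivative of `λ` is at least `-(m + 1) t ^ m`: otherwise `λ' + (m + 1) t ^ m λ`
would become negative and then tend to `-∞`, although `λ' ≥ λ' 0`. -/
lemma neg_decaySolDeriv_le (hm : 0 ≤ m) {t : ℝ} (ht : 1 ≤ t) :
    -decaySolDeriv m t ≤ (m + 1) * (t ^ m * decaySol m t) := by
  by_contra! hcon
  set h : ℝ → ℝ := fun t => decaySolDeriv m t + (m + 1) * (t ^ m * decaySol m t) with hdef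
  have hD : ∀ t, 0 < t → HasDerivAt (fun t => -(Real.exp (-(m + 1) * phase m t) * h t))
      (Real.exp (-(m + 1) * phase m t) *
        (t ^ (2 * m) * decaySol m t * ((m + 1) ^ 2 - 1) -
          (m + 1) * (m * t ^ (m - 1) * decaySol m t))) t := by
    intro t ht
    have h1 := ((hasDerivAt_phase hm ht).const_mul (-(m + 1))).exp
    have h2 := (Real.hasDerivAt_rpow_const (p := m) (Or.inl ht.ne')).mul (hasDerivAt_decaySol hm ht)
    refine (h1.mul ((hasDerivAt_decaySolDeriv hm ht).add
      (h2.const_mul (m + 1)))).neg.congr_deriv ?_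
    have h3 : t ^ (2 * m) = t ^ m * t ^ m := by rw [← Real.rpow_add ht]; ring_nf
    simp only [Pi.add_apply, Pi.mul_apply, h3]
    ring
  have hmono := monotoneOn_Ici_of_hasDerivAt (b := 1)
    (fun t ht => (hD t (lt_of_lt_of_le one_pos ht)).continuousAt.continuousWithinAt)
    (fun t ht => hD t (one_pos.trans ht)) ?_
  · have hneg : h t < 0 := by simp only [hdef]; linarith
    have hlow : ∀ s, 0 ≤ s → decaySolDeriv m 0 ≤ decaySolDeriv m s := fun s hs =>
      monotoneOn_Ici_of_hasDerivAt (continuousOn_decaySolDeriv hm)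
        (fun _ ht => hasDerivAt_decaySolDeriv hm ht)
        (fun t ht => mul_nonneg (by positivity) (decaySol_pos hm ht.le).le)
        (mem_Ici.2 le_rfl) hs hs
    have hlim : Tendsto (fun s => Real.exp ((m + 1) * phase m s)) atTop atTop :=
      Real.tendsto_exp_atTop.comp ((tendsto_phase hm).const_mul_atTop (by positivity))
    have hδ : 0 < -(Real.exp (-(m + 1) * phase m t) * h t) := by
      have := mul_neg_of_pos_of_neg (Real.exp_pos (-(m + 1) * phase m t)) hneg
      linarith
    obtain ⟨s, hs1, hs2⟩ := ((hlim.const_mul_atTop hδ).eventually_gt_atTop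
      (-decaySolDeriv m 0) |>.and (eventually_ge_atTop t)).exists
    have h1 := hmono ht (mem_Ici.2 (ht.trans hs2)) hs2
    have h2 : -(Real.exp (-(m + 1) * phase m s) * h s) * Real.exp ((m + 1) * phase m s) =
        -h s := by
      have : Real.exp (-(m + 1) * phase m s) * Real.exp ((m + 1) * phase m s) = 1 := by
        rw [← Real.exp_add, neg_mul, neg_add_cancel, Real.exp_zero]
      linear_combination (-h s) * this
    have h3 := mul_le_mul_of_nonneg_right h1 (Real.exp_pos ((m + 1) * phase m s)).le
    have hs0 : 0 ≤ s := by linarith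
    have h4 := hlow s hs0
    have h5 : decaySolDeriv m s ≤ h s := by
      have := (decaySol_pos hm hs0).le
      have : 0 ≤ (m + 1) * (s ^ m * decaySol m s) := by positivity
      simp only [hdef]; linarith
    rw [h2] at h3
    linarith
  · intro t ht
    have ht0 : 0 < t := one_pos.trans ht
    have h1 : t ^ (m - 1) ≤ t ^ (2 * m) := Real.rpow_le_rpow_of_exponent_le ht.le (by linarith)
    have h2 := (decaySol_pos hm ht0.le).le
    have h3 : 0 < t ^ (2 * m) := by positivity
    refine mul_nonneg (Real.exp_pos _).le ?_
    have h6 : (m + 1) * m * t ^ (m - 1) ≤ ((m + 1) ^ 2 - 1) * t ^ (2 * m) := by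
      calc _ ≤ (m + 1) * m * t ^ (2 * m) := by gcongr
        _ ≤ _ := by gcongr; nlinarith
    nlinarith [mul_le_mul_of_nonneg_right h6 h2]

/-- The Riccati bounds for `λ` and `μ` make both terms of the Wronskian `λ μ' - λ' μ = 1` comparable
to `λ μ'`. -/
lemma exists_le_decaySol_mul (hm : 0 ≤ m) :
    ∃ c : ℝ, 0 < c ∧ ∀ t, 1 ≤ t → c ≤ decaySol m t * growSolDeriv m t := by
  obtain ⟨c, hc, h⟩ := exists_mul_growSol_le hm
  refine ⟨1 / (1 + (m + 1) / c), by positivity, fun t ht => ?_⟩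
  have ht0 : 0 ≤ t := by linarith
  have h1 := wronskian_growSol hm ht0
  have h2 := mul_le_mul_of_nonneg_right (neg_decaySolDeriv_le hm ht) (growSol_nonneg hm ht0)
  have h3 := mul_le_mul_of_nonneg_left (h t ht) (decaySol_pos hm ht0).le
  rw [div_le_iff₀ (by positivity)]
  have h4 : decaySol m t * (t ^ m * growSol m t) ≤ decaySol m t * growSolDeriv m t / c := by
    rw [le_div_iff₀ hc]; linarith
  have h5 := mul_le_mul_of_nonneg_left h4 (by positivity : 0 ≤ m + 1)
  have h6 : decaySol m t * growSolDeriv m t * (1 + (m + 1) / c) =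
    decaySol m t * growSolDeriv m t + (m + 1) * (decaySol m t * growSolDeriv m t / c) := by ring
  rw [h6]
  linarith

lemma exists_exp_le_growSolDeriv (hm : 0 ≤ m) :
    ∃ c : ℝ, 0 < c ∧ ∀ t, 1 ≤ t →
      c * (t ^ (m / 2) * Real.exp (phase m t)) ≤ growSolDeriv m t := by
  obtain ⟨c, hc, h⟩ := exists_mul_growSol_le hm
  obtain ⟨d, hd, h'⟩ := exists_exp_le_growSol_mul hm
  refine ⟨√(c * d), by positivity, fun t ht => ?_⟩
  have ht0 : 0 < t := by linarith
  have hM := growSolDeriv_pos hm ht0.le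
  refine le_of_sq_le_sq ?_ hM.le
  have e1 : (t ^ (m / 2)) ^ 2 = t ^ m := by
    rw [← Real.rpow_natCast, ← Real.rpow_mul ht0.le]; norm_num
  have e2 : Real.exp (phase m t) ^ 2 = Real.exp (2 * phase m t) := by
    rw [← Real.exp_nat_mul]; norm_num
  rw [mul_pow, mul_pow, Real.sq_sqrt (by positivity), e1, e2]
  have h1 := mul_le_mul_of_nonneg_left (h' t ht) (by positivity : 0 ≤ c * t ^ m)
  have h2 := mul_le_mul_of_nonneg_right (h t ht) hM.le
  nlinarith

end Tricomi

/-! ### Curves in Sobolev spaces as curves in `L²` -/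

namespace Tricomi

variable {n : ℕ}

lemma norm_toC (f : L2 n) : ‖toC f‖ₑ = ‖f‖ₑ := by
  rw [Lp.enorm_def, Lp.enorm_def]
  refine eLpNorm_congr_norm_ae ?_
  filter_upwards [Complex.ofRealCLM.coeFn_compLp f] with x hx
  rw [show (toC f : E n → ℂ) x = _ from hx]
  simp

/-- By Plancherel, the norm of `Hˢ` with `s ≥ 0` dominates that of `L²`. -/
lemma enorm_le_sobolevNorm {s : ℝ} (hs : 0 ≤ s) (f : L2 n) : ‖f‖ₑ ≤ sobolevNorm s f := by
  have h1 : ‖(𝓕 (toC f) : Lp ℂ 2 (volume : Measure (E n)))‖ₑ = ‖f‖ₑ := by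
    rw [← norm_toC, ← ofReal_norm, ← ofReal_norm, Lp.norm_fourier_eq]
  rw [← h1, Lp.enorm_def]
  refine eLpNorm_mono fun ξ => ?_
  rw [norm_mul, Complex.norm_real, Real.norm_of_nonneg (by positivity)]
  refine le_mul_of_one_le_left (norm_nonneg _) (Real.one_le_rpow ?_ (by positivity))
  nlinarith [norm_nonneg ξ]

lemma ContinuousInto.continuousOn {s : ℝ} (hs : 0 ≤ s) {T : ℝ≥0∞} {u : ℝ → L2 n}
    (hu : ContinuousInto s T u) : ContinuousOn u (timeIco T) := by
  intro t ht
  refine tendsto_iff_edist_tendsto_0.2 ?_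
  refine tendsto_of_tendsto_of_tendsto_of_le_of_le tendsto_const_nhds (hu.cont t ht)
    (fun _ => zero_le) fun τ => ?_
  simp only [edist_eq_enorm_sub]
  exact enorm_le_sobolevNorm hs _

lemma HasTimeDeriv.hasDerivWithinAt {s : ℝ} (hs : 0 ≤ s) {T : ℝ≥0∞} {u v : ℝ → L2 n}
    (h : HasTimeDeriv s T u v) {t : ℝ} (ht : t ∈ timeIco T) :
    HasDerivWithinAt u (v t) (timeIco T) t := by
  rw [hasDerivWithinAt_iff_tendsto_slope, tendsto_iff_edist_tendsto_0]
  refine tendsto_of_tendsto_of_tendsto_of_le_of_le tendsto_const_nhds (h t ht)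
    (fun _ => zero_le) fun τ => ?_
  simp only [edist_eq_enorm_sub, slope_def_module]
  exact enorm_le_sobolevNorm hs _

lemma mem_timeIco_of_le {T : ℝ≥0∞} {s t : ℝ} (ht : ENNReal.ofReal t < T) (hs : 0 ≤ s)
    (hst : s ≤ t) : s ∈ timeIco T :=
  ⟨hs, (ENNReal.ofReal_le_ofReal hst).trans_lt ht⟩

/-- The velocity of a curve supported in an increasing family of balls is supported there, because
it is the limit of the difference quotients from the left. -/
lemma ae_eq_zero_of_hasDerivWithinAt {T : ℝ≥0∞} {u v : ℝ → L2 n} {t : ℝ} (ht0 : 0 < t)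
    (ht : t ∈ timeIco T) (h : HasDerivWithinAt u (v t) (timeIco T) t) {S : Set (E n)}
    (hS : ∀ s ∈ Icc 0 t, u s =ᵐ[volume.restrict S] 0) : v t =ᵐ[volume.restrict S] 0 := by
  have h1 : Tendsto (slope u t) (𝓝[Ioo 0 t] t) (𝓝 (v t)) := by
    refine (hasDerivWithinAt_iff_tendsto_slope.1 h).mono_left (nhdsWithin_mono _ ?_)
    exact fun s hs => ⟨mem_timeIco_of_le ht.2 hs.1.le hs.2.le, hs.2.ne⟩
  have h2 : Tendsto (fun s => ‖v t - slope u t s‖ₑ) (𝓝[Ioo 0 t] t) (𝓝 0) := by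
    have := tendsto_iff_edist_tendsto_0.1 h1
    simpa only [edist_comm _ (v t), edist_eq_enorm_sub] using this
  have h3 : eLpNorm (v t) 2 (volume.restrict S) ≤ 0 := by
    have : (𝓝[Ioo 0 t] t).NeBot := by
      rw [← mem_closure_iff_nhdsWithin_neBot, closure_Ioo ht0.ne]
      exact ⟨ht0.le, le_rfl⟩
    refine ge_of_tendsto h2 ?_
    filter_upwards [self_mem_nhdsWithin] with s hs
    have h4 : (slope u t s : E n → ℝ) =ᵐ[volume.restrict S] 0 := by
      rw [slope_def_module]
      filter_upwards [ae_restrict_of_ae (Lp.coeFn_smul (s - t)⁻¹ (u s - u t)),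
        ae_restrict_of_ae (Lp.coeFn_sub (u s) (u t)), hS s ⟨hs.1.le, hs.2.le⟩,
        hS t ⟨ht0.le, le_rfl⟩] with x e1 e2 e3 e4
      rw [e1, Pi.smul_apply, e2, Pi.sub_apply, e3, e4]
      simp
    have h5 : (v t : E n → ℝ) =ᵐ[volume.restrict S] (v t - slope u t s : L2 n) := by
      filter_upwards [ae_restrict_of_ae (Lp.coeFn_sub (v t) (slope u t s)), h4] with x e1 e2
      rw [e1, Pi.sub_apply, e2]
      simp
    rw [eLpNorm_congr_ae h5, Lp.enorm_def]
    exact eLpNorm_mono_measure _ Measure.restrict_le_self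
  exact (eLpNorm_eq_zero_iff ((Lp.aestronglyMeasurable _).restrict) (by norm_num)).1
    (le_antisymm h3 zero_le)

/-! ### The plane wave `exp (x i)` and its truncations -/

/-- `Φ` is a smooth compactly supported nonnegative function that coincides with the plane wave
`exp (x i)`, a positive solution of `Δφ = φ`, on a neighbourhood of the ball `‖x‖ ≤ R`. -/
structure IsTruncatedWave (i : Fin n) (R : ℝ) (Φ : E n → ℝ) : Prop where
  smooth : ContDiff ℝ ∞ Φ
  compact : HasCompactSupport Φ
  nonneg : ∀ x, 0 ≤ Φ x
  eq_exp : ∀ x, ‖x‖ < R + 1 → Φ x = Real.exp (x i)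

lemma exists_isTruncatedWave (i : Fin n) {R : ℝ} (hR : 0 ≤ R) : ∃ Φ, IsTruncatedWave i R Φ := by
  let b : ContDiffBump (0 : E n) := ⟨R + 1, R + 2, by positivity, by linarith⟩
  refine ⟨fun x => b x * Real.exp (x i), ?_, ?_, ?_, ?_⟩
  · have : ContDiff ℝ ∞ (fun x : E n => x i) := (EuclideanSpace.proj (𝕜 := ℝ) i).contDiff
    exact b.contDiff.mul this.exp
  · exact b.hasCompactSupport.mul_right
  · exact fun x => mul_nonneg b.nonneg (Real.exp_pos _).le
  · intro x hx
    rw [b.one_of_mem_closedBall (by simpa [b] using hx.le), one_mul]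

namespace IsTruncatedWave

variable {i : Fin n} {R : ℝ} {Φ : E n → ℝ}

lemma memLp (h : IsTruncatedWave i R Φ) : MemLp Φ 2 volume :=
  h.smooth.continuous.memLp_of_hasCompactSupport h.compact

lemma integrable_mul (h : IsTruncatedWave i R Φ) (f : L2 n) : Integrable (fun x => f x * Φ x) :=
  (Lp.memLp f).integrable_mul h.memLp

lemma integral_mul_eq_inner (h : IsTruncatedWave i R Φ) (f : L2 n) :
    ∫ x, f x * Φ x = inner ℝ (h.memLp.toLp Φ) f := by
  rw [L2.inner_def]
  refine integral_congr_ae ?_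
  filter_upwards [h.memLp.coeFn_toLp] with x hx
  simp [hx]

lemma partial_smooth (h : IsTruncatedWave i R Φ) (e : E n) :
    ContDiff ℝ ∞ (fun x => fderiv ℝ Φ x e) :=
  (h.smooth.fderiv_right (m := ∞) (by simp)).clm_apply contDiff_const

lemma partial_compact (h : IsTruncatedWave i R Φ) (e : E n) :
    HasCompactSupport (fun x => fderiv ℝ Φ x e) :=
  h.compact.fderiv_apply ℝ e

lemma fderiv_eq (h : IsTruncatedWave i R Φ) {x : E n} (hx : ‖x‖ < R + 1) (e : E n) :
    fderiv ℝ Φ x e = Real.exp (x i) * e i := by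
  have h1 : Φ =ᶠ[𝓝 x] fun x => Real.exp (x i) := by
    filter_upwards [(isOpen_lt continuous_norm continuous_const).mem_nhds hx] with y hy
    exact h.eq_exp y hy
  have h2 : HasFDerivAt (fun x : E n => Real.exp (x i))
      (Real.exp (x i) • (EuclideanSpace.proj (𝕜 := ℝ) i : E n →L[ℝ] ℝ)) x :=
    ((EuclideanSpace.proj (𝕜 := ℝ) i).hasFDerivAt (x := x)).exp
  rw [h1.fderiv_eq, h2.fderiv]
  simp

lemma fderiv_fderiv_eq (h : IsTruncatedWave i R Φ) {x : E n} (hx : ‖x‖ < R + 1) (e : E n) :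
    fderiv ℝ (fun y => fderiv ℝ Φ y e) x e = Φ x * e i * e i := by
  have h1 : (fun y => fderiv ℝ Φ y e) =ᶠ[𝓝 x] fun y => Φ y * e i := by
    filter_upwards [(isOpen_lt continuous_norm continuous_const).mem_nhds hx] with y hy
    rw [h.fderiv_eq hy, h.eq_exp y hy]
  rw [h1.fderiv_eq, fderiv_mul_const (h.smooth.differentiable (by simp) x)]
  simp only [smul_apply, smul_eq_mul]
  rw [h.fderiv_eq hx, h.eq_exp x hx]
  ring

/-- Since `ΔΦ = Φ` near the support of `f`, integration by parts replaces `∇f · ∇Φ` by `-f Φ`. -/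
lemma integral_inner_gradient (h : IsTruncatedWave i R Φ) {f : L2 n}
    {G : Lp (E n) 2 (volume : Measure (E n))} (hG : IsWeakGradient f G)
    (hf : ∀ᵐ x, R < ‖x‖ → f x = 0) :
    ∫ x, inner ℝ (G x) (gradient Φ x) = -∫ x, f x * Φ x := by
  have hcomp : ∀ (φ : E n → ℝ), ContDiff ℝ ∞ φ → HasCompactSupport φ → ∀ j : Fin n,
      Integrable (fun x => φ x * G x j) ∧
      ∫ x, φ x * G x j = -∫ x, f x * fderiv ℝ φ x (EuclideanSpace.single j 1) := by
    intro φ hφ hφc j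
    have hφ2 : MemLp φ 2 volume := hφ.continuous.memLp_of_hasCompactSupport hφc
    have i1 : Integrable (fun x => φ x • G x) := memLp_one_iff_integrable.1 ((Lp.memLp G).smul hφ2)
    have hcg : Continuous (gradient φ) :=
      (InnerProductSpace.toDual ℝ (E n)).symm.continuous.comp (hφ.continuous_fderiv (by simp))
    have hsg : HasCompactSupport (gradient φ) :=
      (hφc.fderiv ℝ).comp_left (map_zero (InnerProductSpace.toDual ℝ (E n)).symm)
    have i2 : Integrable (fun x => f x • gradient φ x) :=
      memLp_one_iff_integrable.1
      ((hcg.memLp_of_hasCompactSupport (p := 2) (μ := volume) hsg).smul (Lp.memLp f))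
    have h1 := congrArg (EuclideanSpace.proj (𝕜 := ℝ) j) (hG φ hφ hφc)
    rw [map_neg, ← ContinuousLinearMap.integral_comp_comm _ i1,
      ← ContinuousLinearMap.integral_comp_comm _ i2] at h1
    refine ⟨(EuclideanSpace.proj (𝕜 := ℝ) j).integrable_comp i1, ?_⟩
    have h2 : ∀ x, gradient φ x j = fderiv ℝ φ x (EuclideanSpace.single j 1) := by
      intro x
      rw [← inner_gradient_left, EuclideanSpace.inner_single_right]
      simp
    simp only [PiLp.proj_apply, PiLp.smul_apply, smul_eq_mul, h2] at h1
    rw [h1, neg_neg]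
  have hsum : ∀ x, inner ℝ (G x) (gradient Φ x) =
      ∑ j, fderiv ℝ Φ x (EuclideanSpace.single j 1) * G x j := by
    intro x
    rw [PiLp.inner_apply]
    refine Finset.sum_congr rfl fun j _ => ?_
    have : gradient Φ x j = fderiv ℝ Φ x (EuclideanSpace.single j 1) := by
      rw [← inner_gradient_left, EuclideanSpace.inner_single_right]
      simp
    simp [this]
  simp_rw [hsum]
  rw [integral_finsetSum _ fun j _ => (hcomp _ (h.partial_smooth _) (h.partial_compact _) j).1]
  have hterm : ∀ j, ∫ x, fderiv ℝ Φ x (EuclideanSpace.single j 1) * G x j =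
      if j = i then -∫ x, f x * Φ x else 0 := by
    intro j
    rw [(hcomp _ (h.partial_smooth _) (h.partial_compact _) j).2]
    have : ∫ x, f x * fderiv ℝ (fun y => fderiv ℝ Φ y (EuclideanSpace.single j 1)) x
        (EuclideanSpace.single j 1) = ∫ x, f x * Φ x * (if j = i then 1 else 0) := by
      refine integral_congr_ae ?_
      filter_upwards [hf] with x hx
      by_cases hxR : R < ‖x‖
      · simp [hx hxR]
      · rw [h.fderiv_fderiv_eq (by linarith)]
        by_cases hj : j = i
        · subst hj; simp
        · simp [hj, Ne.symm hj]
    rw [this]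
    split_ifs <;> simp
  simp [hterm]

end IsTruncatedWave

/-- On the ball `‖x‖ ≤ R` one has `x i ≤ R - ‖x'‖² / (2R)`, where `x'` collects the other
coordinates. Hence the plane wave is dominated there by a product of one exponential and `n - 1`
Gaussians, whose integral has the sharp growth `R ^ ((n - 1) / 2) exp R`. -/
lemma setIntegral_exp_le (i : Fin n) {R : ℝ} (hR : 0 < R) :
    ∫ x in {x : E n | ‖x‖ ≤ R}, Real.exp (x i) ≤
      2 * (4 * Real.pi) ^ (((n : ℝ) - 1) / 2) * (R ^ (((n : ℝ) - 1) / 2) * Real.exp R) := by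
  classical
  set F : Fin n → ℝ → ℝ := fun j s =>
    if j = i then (Iic R).indicator (fun s => Real.exp (1 / 2 * s)) s
    else Real.exp (-(1 / (4 * R)) * s ^ 2) with hF
  have hFint : ∀ j, Integrable (F j) := by
    intro j
    by_cases hj : j = i
    · simp only [hF, hj, if_true]
      exact (integrable_indicator_iff measurableSet_Iic).2
        (integrableOn_exp_mul_Iic (by norm_num) R)
    · simp only [hF, hj, if_false]
      exact integrable_exp_neg_mul_sq (by positivity)
  have hFi : ∫ s, F i s = 2 * Real.exp (R / 2) := by
    simp only [hF, if_true]
    rw [integral_indicator measurableSet_Iic, integral_exp_mul_Iic (by norm_num)]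
    ring_nf
  have hFj : ∀ j, j ≠ i → ∫ s, F j s = √(4 * Real.pi * R) := by
    intro j hj
    simp only [hF, hj, if_false]
    rw [integral_gaussian]
    congr 1
    field_simp
  have hprod : ∫ x : E n, ∏ j, F j (x j) = 2 * Real.exp (R / 2) * √(4 * Real.pi * R) ^ (n - 1) := by
    have e := (EuclideanSpace.volume_preserving_symm_measurableEquiv_toLp (Fin n)).integral_comp'
      (fun y : Fin n → ℝ => ∏ j, F j (y j))
    have e' : ∫ x : E n, ∏ j, F j (x j) = ∫ y : Fin n → ℝ, ∏ j, F j (y j) := by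
      rw [← e]; rfl
    rw [e', integral_fintype_prod_volume_eq_prod, ← Finset.mul_prod_erase _ _ (Finset.mem_univ i),
      hFi, Finset.prod_congr rfl fun j hj => hFj j (Finset.ne_of_mem_erase hj)]
    simp
  have hint : Integrable (fun x : E n => ∏ j, F j (x j)) := by
    have h1 : Integrable (fun y : Fin n → ℝ => ∏ j, F j (y j)) :=
      Integrable.fintype_prod hFint
    exact (EuclideanSpace.volume_preserving_symm_measurableEquiv_toLp
      (Fin n)).integrable_comp_of_integrable h1
  have hFnonneg : ∀ x : E n, 0 ≤ ∏ j, F j (x j) := by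
    refine fun x => Finset.prod_nonneg fun j _ => ?_
    simp only [hF]
    split_ifs
    · exact indicator_nonneg (fun _ _ => (Real.exp_pos _).le) _
    · positivity
  have hmeas : MeasurableSet {x : E n | ‖x‖ ≤ R} :=
    (isClosed_le continuous_norm continuous_const).measurableSet
  have hpt : ∀ x ∈ {x : E n | ‖x‖ ≤ R},
      Real.exp (x i) ≤ Real.exp (R / 2) * ∏ j, F j (x j) := by
    intro x hx
    have hx' : ‖x‖ ≤ R := hx
    have hxi : |x i| ≤ R := (PiLp.norm_apply_le x i).trans hx'
    have hxiR : x i ≤ R := (le_abs_self _).trans hxi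
    have hsq : x i ^ 2 + ∑ j ∈ Finset.univ.erase i, x j ^ 2 ≤ R ^ 2 := by
      rw [Finset.add_sum_erase _ (fun j => x j ^ 2) (Finset.mem_univ i)]
      calc ∑ j, x j ^ 2 = ‖x‖ ^ 2 := by rw [EuclideanSpace.real_norm_sq_eq]
        _ ≤ R ^ 2 := by gcongr
    have e : Real.exp (R / 2) * ∏ j, F j (x j) = Real.exp (R / 2 + 1 / 2 * x i +
        -(1 / (4 * R)) * ∑ j ∈ Finset.univ.erase i, x j ^ 2) := by
      rw [← Finset.mul_prod_erase _ _ (Finset.mem_univ i), Finset.prod_congr rfl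
        fun j hj => show F j (x j) = Real.exp (-(1 / (4 * R)) * x j ^ 2) by
          simp [hF, Finset.ne_of_mem_erase hj]]
      rw [← Real.exp_sum, ← Finset.mul_sum]
      simp only [hF, if_true, indicator_of_mem (show x i ∈ Iic R from hxiR)]
      rw [← mul_assoc, ← Real.exp_add, ← Real.exp_add]
    rw [e]
    refine Real.exp_le_exp.2 ?_
    set S := ∑ j ∈ Finset.univ.erase i, x j ^ 2
    have h1 : S ≤ 2 * R * (R - x i) := by nlinarith [abs_le.1 hxi]
    have h2 : 1 / (4 * R) * S ≤ (R - x i) / 2 := by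
      rw [one_div, inv_mul_le_iff₀ (by positivity)]
      linarith
    linarith
  have hpow : √(4 * Real.pi * R) ^ (n - 1) =
      (4 * Real.pi) ^ (((n : ℝ) - 1) / 2) * R ^ (((n : ℝ) - 1) / 2) := by
    have hn : 1 ≤ n := i.pos
    rw [← Real.mul_rpow (by positivity) hR.le, Real.sqrt_eq_rpow, ← Real.rpow_natCast,
      ← Real.rpow_mul (by positivity), Nat.cast_sub hn]
    congr 1
    push_cast
    ring
  calc ∫ x in {x : E n | ‖x‖ ≤ R}, Real.exp (x i)
      ≤ ∫ x in {x : E n | ‖x‖ ≤ R}, Real.exp (R / 2) * ∏ j, F j (x j) := by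
        refine setIntegral_mono_on ?_ (hint.const_mul _).integrableOn hmeas hpt
        refine ContinuousOn.integrableOn_compact ?_ (by fun_prop)
        have : {x : E n | ‖x‖ ≤ R} = Metric.closedBall 0 R := by ext; simp
        rw [this]
        exact isCompact_closedBall _ _
    _ ≤ ∫ x : E n, Real.exp (R / 2) * ∏ j, F j (x j) :=
        setIntegral_le_integral (hint.const_mul _)
          (Eventually.of_forall fun x => mul_nonneg (Real.exp_pos _).le (hFnonneg x))
    _ = _ := by
        have : Real.exp R = Real.exp (R / 2) * Real.exp (R / 2) := by
          rw [← Real.exp_add]; ring_nf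
        rw [integral_const_mul, hprod, hpow, this]
        ring

end Tricomi

/-! ### Reduction of the weak formulation to an ordinary differential equation -/

namespace Tricomi

variable {n : ℕ}

/-- The moment `∫ f Φ` of an `L²` function against a weight `Φ`. -/
noncomputable def moment (Φ : E n → ℝ) (f : L2 n) : ℝ := ∫ x, f x * Φ x

/-- The moment `∫ |w (t, x)| ^ p Φ x dx` of the nonlinear term at time `t`. -/
noncomputable def sourceMoment (p : ℝ) (Φ : E n → ℝ) (w : ℝ × E n → ℝ) (t : ℝ) : ℝ :=
  ∫ x, |w (t, x)| ^ p * Φ x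

lemma timeIoo_measurable (T : ℝ≥0∞) : MeasurableSet (timeIoo T) :=
  measurableSet_Ioi.inter (measurableSet_lt ENNReal.measurable_ofReal measurable_const)

lemma Ioc_subset_timeIoo {T : ℝ≥0∞} {b : ℝ} (hbT : ENNReal.ofReal b < T) :
    Ioc 0 b ⊆ timeIoo T :=
  fun _ ht => ⟨ht.1, (ENNReal.ofReal_le_ofReal ht.2).trans_lt hbT⟩

lemma isTestFunction_mul {T : ℝ≥0∞} {b : ℝ} (hbT : ENNReal.ofReal b < T) {η : ℝ → ℝ}
    (hη : ContDiff ℝ ∞ η) (hη0 : ∀ t, b ≤ t → η t = 0) {Φ : E n → ℝ} (hΦ : ContDiff ℝ ∞ Φ)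
    (hΦc : HasCompactSupport Φ) : IsTestFunction T (fun z => η z.1 * Φ z.2) := by
  have h : ContDiff ℝ ∞ (fun z : ℝ × E n => η z.1 * Φ z.2) :=
    (hη.comp contDiff_fst).mul (hΦ.comp contDiff_snd)
  refine ⟨(h.of_le (by simp)).contDiffOn, h.contDiffOn,
    Icc 0 b ×ˢ tsupport Φ, isCompact_Icc.prod hΦc, ?_, ?_⟩
  · exact fun z hz => ⟨mem_timeIco_of_le hbT hz.1.1 hz.1.2, mem_univ _⟩
  · intro z hz hzK
    by_cases hzb : b ≤ z.1
    · simp [hη0 _ hzb]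
    · have : z.2 ∉ tsupport Φ := fun h => hzK ⟨⟨hz.1.1, (not_le.1 hzb).le⟩, h⟩
      simp [image_eq_zero_of_notMem_tsupport this]

section

variable {i : Fin n} {R : ℝ} {Φ : E n → ℝ}

lemma IsTruncatedWave.moment_eq_inner (h : IsTruncatedWave i R Φ) (f : L2 n) :
    moment Φ f = innerSL ℝ (h.memLp.toLp Φ) f :=
  h.integral_mul_eq_inner f

lemma IsTruncatedWave.moment_smul (h : IsTruncatedWave i R Φ) (c : ℝ) (f : L2 n) :
    moment Φ (c • f) = c * moment Φ f := by
  rw [h.moment_eq_inner, h.moment_eq_inner, map_smul, smul_eq_mul]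

lemma IsTruncatedWave.continuousOn_moment (h : IsTruncatedWave i R Φ) {u : ℝ → L2 n} {S : Set ℝ}
    (hu : ContinuousOn u S) : ContinuousOn (fun t => moment Φ (u t)) S := by
  simp_rw [h.moment_eq_inner]
  exact (innerSL ℝ (h.memLp.toLp Φ)).continuous.comp_continuousOn hu

lemma IsTruncatedWave.hasDerivWithinAt_moment (h : IsTruncatedWave i R Φ) {u : ℝ → L2 n}
    {v : L2 n} {S : Set ℝ} {t : ℝ} (hu : HasDerivWithinAt u v S t) :
    HasDerivWithinAt (fun t => moment Φ (u t)) (moment Φ v) S t := by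
  simp_rw [h.moment_eq_inner]
  exact (innerSL ℝ (h.memLp.toLp Φ)).hasFDerivAt.comp_hasDerivWithinAt t hu

end

section EnergySolution

variable {m p ε : ℝ} {f g : L2 n} {T : ℝ≥0∞} {u v : ℝ → L2 n} {w : ℝ × E n → ℝ}
  {G : ℝ → Lp (E n) 2 (volume : Measure (E n))} {b : ℝ} {i : Fin n} {Φ : E n → ℝ}

lemma sobolev_index_nonneg (hm : 0 ≤ m) : 0 ≤ 1 - 1 / (m + 1) := by
  rw [sub_nonneg, div_le_one (by positivity)]
  linarith

/-- The source moment is integrable up to `t = 0`. -/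
lemma IsEnergySolutionWith.integrable_source (h : IsEnergySolutionWith m p ε f g T u v w G)
    (hbT : ENNReal.ofReal b < T) {R : ℝ} (hΦ : IsTruncatedWave i R Φ) :
    Integrable (fun z : ℝ × E n => |w z| ^ p * Φ z.2)
      ((volume.restrict (Ioc 0 b)).prod volume) := by
  obtain ⟨b', -, hbb', hb'T⟩ := ENNReal.lt_iff_exists_real_btwn.1 hbT
  have hlt : b < b' := by
    by_contra! hle
    exact absurd hbb' (not_lt.2 (ENNReal.ofReal_le_ofReal hle))
  set η : ℝ → ℝ := fun s => Real.smoothTransition ((b' - s) / (b' - b)) with hη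
  have hηs : ContDiff ℝ ∞ η := by
    have : ContDiff ℝ ∞ (fun s : ℝ => (b' - s) / (b' - b)) :=
      (contDiff_const.sub contDiff_id).div_const _
    exact Real.smoothTransition.contDiff.comp this
  have hη0 : ∀ t, b' ≤ t → η t = 0 := fun t ht =>
    Real.smoothTransition.zero_of_nonpos
      (div_nonpos_of_nonpos_of_nonneg (by linarith) (by linarith))
  have hη1 : ∀ t, t ≤ b → η t = 1 := fun t ht =>
    Real.smoothTransition.one_of_one_le ((one_le_div (by linarith)).2 (by linarith))
  have h1 := (h.integrable _ (isTestFunction_mul hb'T hηs hη0 hΦ.smooth hΦ.compact)).mono_set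
    (prod_mono_left (Ioc_subset_timeIoo hbT))
  have h2 : IntegrableOn (fun z : ℝ × E n => |w z| ^ p * Φ z.2) (Ioc 0 b ×ˢ univ) := by
    refine h1.congr_fun (fun z hz => ?_) (measurableSet_Ioc.prod MeasurableSet.univ)
    simp [hη1 z.1 hz.1.2]
  rwa [IntegrableOn, Measure.volume_eq_prod, ← Measure.prod_restrict, Measure.restrict_univ] at h2

lemma IsEnergySolutionWith.intervalIntegrable_source
    (h : IsEnergySolutionWith m p ε f g T u v w G) (hb : 0 ≤ b)
    (hbT : ENNReal.ofReal b < T) {R : ℝ} (hΦ : IsTruncatedWave i R Φ) :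
    IntervalIntegrable (sourceMoment p Φ w) volume 0 b := by
  rw [intervalIntegrable_iff_integrableOn_Ioc_of_le hb]
  exact (h.integrable_source hbT hΦ).integral_prod_left

/-- The weak formulation tested with `η(t) Φ(x)`. -/
lemma IsEnergySolutionWith.weak_moment (h : IsEnergySolutionWith m p ε f g T u v w G)
    (hm : 0 ≤ m) (hcone : SupportedInCone m T u) (hb : 0 < b) (hbT : ENNReal.ofReal b < T)
    (hΦ : IsTruncatedWave i (1 + phase m b) Φ) {η : ℝ → ℝ} (hη : ContDiff ℝ ∞ η)
    (hη0 : ∀ t, b ≤ t → η t = 0) :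
    η 0 * moment Φ (v 0) + ∫ t in (0)..b, η t * sourceMoment p Φ w t =
      -(∫ t in (0)..b, deriv η t * moment Φ (v t)) -
        ∫ t in (0)..b, η t * (t ^ (2 * m) * moment Φ (u t)) := by
  have hsub := Ioc_subset_timeIoo hbT
  have hη0' : ∀ t, t ∈ timeIoo T \ Ioc 0 b → η t = 0 ∧ deriv η t = 0 := by
    rintro t ⟨ht1, ht2⟩
    have hbt : b < t := by
      by_contra! hle
      exact ht2 ⟨ht1.1, hle⟩
    refine ⟨hη0 t hbt.le, ?_⟩
    have : η =ᶠ[𝓝 t] fun _ => 0 := by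
      filter_upwards [Ioi_mem_nhds hbt] with s hs
      exact hη0 s (le_of_lt hs)
    rw [this.deriv_eq, deriv_const]
  have hweak := h.weak _ (isTestFunction_mul hbT hη hη0 hΦ.smooth hΦ.compact)
  have e0 : ε * ∫ x, g x * (η 0 * Φ x) = η 0 * moment Φ (v 0) := by
    rw [h.init_v, hΦ.moment_smul, moment]
    simp_rw [mul_left_comm _ (η 0)]
    rw [integral_const_mul]
    ring
  have e1 : ∫ t in timeIoo T, ∫ x, |w (t, x)| ^ p * (η t * Φ x) =
      ∫ t in (0)..b, η t * sourceMoment p Φ w t := by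
    rw [intervalIntegral.integral_of_le hb.le,
      setIntegral_eq_of_subset_of_forall_sdiff_eq_zero (timeIoo_measurable T) hsub
        (fun t ht => by simp [(hη0' t ht).1])]
    refine setIntegral_congr_fun measurableSet_Ioc fun t _ => ?_
    simp_rw [mul_left_comm _ (η t)]
    rw [integral_const_mul]
    rfl
  have e2 : ∫ t in timeIoo T, ∫ x, -(w (t, x)) * deriv (fun τ => η τ * Φ x) t =
      -∫ t in (0)..b, deriv η t * moment Φ (v t) := by
    have hd : ∀ t x, deriv (fun τ => η τ * Φ x) t = deriv η t * Φ x := fun t x =>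
      deriv_mul_const ((hη.differentiable (by simp)) t) _
    simp_rw [hd]
    rw [intervalIntegral.integral_of_le hb.le,
      setIntegral_eq_of_subset_of_forall_sdiff_eq_zero (timeIoo_measurable T) hsub
        (fun t ht => by simp [(hη0' t ht).2]), ← integral_neg]
    refine setIntegral_congr_ae measurableSet_Ioc ?_
    filter_upwards [(ae_restrict_iff' (timeIoo_measurable T)).1 h.rep_v] with t ht htb
    rw [moment, ← integral_const_mul, ← integral_neg]
    refine integral_congr_ae ?_
    filter_upwards [ht (hsub htb)] with x hx
    rw [hx]
    ring
  have e3 : ∫ t in timeIoo T, ∫ x,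
        t ^ (2 * m) * inner ℝ (G t x) (gradient (fun y => η t * Φ y) x) =
      -∫ t in (0)..b, η t * (t ^ (2 * m) * moment Φ (u t)) := by
    have hgr : ∀ t x, gradient (fun y => η t * Φ y) x = η t • gradient Φ x := by
      intro t x
      unfold gradient
      rw [fderiv_const_mul (hΦ.smooth.differentiable (by simp) x)]
      simp
    simp_rw [hgr]
    rw [intervalIntegral.integral_of_le hb.le,
      setIntegral_eq_of_subset_of_forall_sdiff_eq_zero (timeIoo_measurable T) hsub
        (fun t ht => by simp [(hη0' t ht).1]), ← integral_neg]
    refine setIntegral_congr_fun measurableSet_Ioc fun t ht => ?_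
    have htT : t ∈ timeIco T := mem_timeIco_of_le hbT ht.1.le ht.2
    have hsupp : ∀ᵐ x, 1 + phase m b < ‖x‖ → u t x = 0 := by
      filter_upwards [hcone t htT] with x hx hxR
      refine hx (lt_of_le_of_lt ?_ hxR)
      have := phase_mono hm ht.1.le ht.2
      simpa [phase] using this
    have := hΦ.integral_inner_gradient (h.grad_u t htT) hsupp
    simp only [inner_smul_right]
    rw [integral_const_mul, integral_const_mul, this, moment]
    ring
  rw [e0, e1, e2, e3] at hweak
  rw [hweak]
  ring

/-- The moments `U = ∫ u Φ` and `F = ∫ u_t Φ` satisfy `F' = ∫ |u_t| ^ p Φ + t ^ (2m) U` in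
integrated form. -/
lemma IsEnergySolutionWith.moment_eq_integral (h : IsEnergySolutionWith m p ε f g T u v w G)
    (hm : 0 ≤ m) (hcone : SupportedInCone m T u) (hb : 0 < b) (hbT : ENNReal.ofReal b < T)
    (hΦ : IsTruncatedWave i (1 + phase m b) Φ) {t : ℝ} (ht : t ∈ Icc 0 b) :
    moment Φ (v t) = moment Φ (v 0) +
      ∫ s in (0)..t, (sourceMoment p Φ w s + s ^ (2 * m) * moment Φ (u s)) := by
  have hsubI : Icc 0 b ⊆ timeIco T := fun s hs => mem_timeIco_of_le hbT hs.1 hs.2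
  have hUc : ContinuousOn (fun t => moment Φ (u t)) (Icc 0 b) :=
    hΦ.continuousOn_moment ((h.cont_u.continuousOn zero_le_one).mono hsubI)
  have hFc : ContinuousOn (fun t => moment Φ (v t)) (Icc 0 b) :=
    hΦ.continuousOn_moment ((h.cont_v.continuousOn (sobolev_index_nonneg hm)).mono hsubI)
  set r : ℝ → ℝ := fun s => sourceMoment p Φ w s + s ^ (2 * m) * moment Φ (u s) with hr
  have htc : ContinuousOn (fun s : ℝ => s ^ (2 * m)) (Icc 0 b) :=
    (Real.continuous_rpow_const (by positivity)).continuousOn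
  have hi1 := h.intervalIntegrable_source hb.le hbT hΦ
  have hi2 : IntervalIntegrable (fun s => s ^ (2 * m) * moment Φ (u s)) volume 0 b :=
    ContinuousOn.intervalIntegrable_of_Icc hb.le (htc.mul hUc)
  have hri : IntervalIntegrable r volume 0 b := hi1.add hi2
  set H : ℝ → ℝ := fun t => ∫ s in (0)..t, r s with hH
  have hHac : AbsolutelyContinuousOnInterval H 0 b :=
    hri.absolutelyContinuousOnInterval_intervalIntegral (by simp)
  have hHc : ContinuousOn H (Icc 0 b) := by
    have := hHac.continuousOn
    rwa [uIcc_of_le hb.le] at this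
  set D : ℝ → ℝ := fun t => moment Φ (v t) - moment Φ (v 0) - H t with hD
  have hDc : ContinuousOn D (Icc 0 b) := (hFc.sub continuousOn_const).sub hHc
  -- Every smooth `θ` supported in `(0, b)` is the derivative of an admissible `η`, so testing with
  -- `η` and integrating by parts shows that `D` is orthogonal to all `θ`.
  have horth : ∀ θ : ℝ → ℝ, ContDiff ℝ ∞ θ → HasCompactSupport θ → tsupport θ ⊆ Ioo 0 b →
      ∫ x, θ x • D x = 0 := by
    intro θ hθ _ hθs
    have hθ0 : ∀ x, x ∉ Ioo 0 b → θ x = 0 := fun x hx =>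
      image_eq_zero_of_notMem_tsupport fun hx' => hx (hθs hx')
    set η : ℝ → ℝ := fun t => ∫ s in b..t, θ s with hη
    have hder : ∀ t, HasDerivAt η (θ t) t := fun t => hθ.continuous.integral_hasStrictDerivAt b t
      |>.hasDerivAt
    have hderiv : deriv η = θ := funext fun t => (hder t).deriv
    have hηs : ContDiff ℝ ∞ η := by
      rw [contDiff_infty_iff_deriv, hderiv]
      exact ⟨fun t => (hder t).differentiableAt, hθ⟩
    have hη0 : ∀ t, b ≤ t → η t = 0 := by
      intro t ht
      have : ∫ s in b..t, θ s = ∫ s in b..t, (0 : ℝ) := by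
        refine intervalIntegral.integral_congr fun s hs => hθ0 s fun hs' => ?_
        rw [uIcc_of_le ht] at hs
        exact absurd hs'.2 (not_lt.2 hs.1)
      simp only [hη, this, intervalIntegral.integral_zero]
    have hw := h.weak_moment hm hcone hb hbT hΦ hηs hη0
    rw [hderiv] at hw
    have hηac : AbsolutelyContinuousOnInterval η 0 b :=
      (hηs.of_le (by simp)).contDiffOn.absolutelyContinuousOnInterval
    have hparts := hηac.integral_mul_deriv_eq_deriv_mul hHac
    rw [hderiv, hη0 b le_rfl] at hparts
    have hHder : ∫ x in (0)..b, η x * deriv H x = ∫ x in (0)..b, η x * r x := by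
      refine intervalIntegral.integral_congr_ae ?_
      filter_upwards [hri.ae_hasDerivAt_integral] with x hx hxb
      rw [(hx (uIoc_subset_uIcc hxb) 0 (by simp)).deriv]
    have hH0 : H 0 = 0 := by simp [hH]
    have hηcb : ContinuousOn η (uIcc 0 b) := hηs.continuous.continuousOn
    have hθcb : ContinuousOn θ (uIcc 0 b) := hθ.continuous.continuousOn
    have hFi : IntervalIntegrable (fun t => moment Φ (v t)) volume 0 b :=
      hFc.intervalIntegrable_of_Icc hb.le
    have hHi : IntervalIntegrable H volume 0 b := hHc.intervalIntegrable_of_Icc hb.le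
    have hsplit : ∫ x in (0)..b, η x * r x = (∫ x in (0)..b, η x * sourceMoment p Φ w x) +
        ∫ x in (0)..b, η x * (x ^ (2 * m) * moment Φ (u x)) := by
      rw [← intervalIntegral.integral_add (hi1.continuousOn_mul hηcb) (hi2.continuousOn_mul hηcb)]
      simp only [hr, mul_add]
    have hθint : ∫ x in (0)..b, θ x = -η 0 := by
      rw [hη, ← intervalIntegral.integral_symm]
    have hDint : ∫ x in (0)..b, θ x * D x = (∫ x in (0)..b, θ x * moment Φ (v x)) -
        (∫ x in (0)..b, θ x) * moment Φ (v 0) - ∫ x in (0)..b, θ x * H x := by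
      rw [← intervalIntegral.integral_mul_const, ← intervalIntegral.integral_sub
        (hFi.continuousOn_mul hθcb) ((hθ.continuous.intervalIntegrable _ _).mul_const _),
        ← intervalIntegral.integral_sub ((hFi.continuousOn_mul hθcb).sub
          ((hθ.continuous.intervalIntegrable _ _).mul_const _)) (hHi.continuousOn_mul hθcb)]
      simp only [hD, mul_sub]
    have hall : ∫ x, θ x • D x = ∫ x in (0)..b, θ x * D x := by
      rw [intervalIntegral.integral_of_le hb.le, setIntegral_eq_integral_of_forall_compl_eq_zero]
      · rfl
      · intro x hx
        rw [hθ0 x fun hx' => hx ⟨hx'.1, hx'.2.le⟩, zero_mul]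
    rw [hall, hDint, hθint]
    rw [hHder, hsplit, hH0] at hparts
    linarith
  have hae := isOpen_Ioo.ae_eq_zero_of_integral_contDiff_smul_eq_zero (U := Ioo 0 b) (f := D)
    (μ := volume) ((hDc.mono Ioo_subset_Icc_self).locallyIntegrableOn measurableSet_Ioo) horth
  have hzero : EqOn D (fun _ => 0) (Icc 0 b) := by
    refine Measure.eqOn_Icc_of_ae_eq volume hb.ne ?_ hDc continuousOn_const
    rw [EventuallyEq, restrict_Ioo_eq_restrict_Icc.symm, ae_restrict_iff' measurableSet_Ioo]
    exact hae
  have := hzero ht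
  simp only [hD] at this
  linarith

/-- Tangent line inequality for the convex function `y ↦ y ^ p` at `s > 0`. -/
lemma tangent_le_rpow {p s y : ℝ} (hp : 1 ≤ p) (hs : 0 < s) (hy : 0 ≤ y) :
    p * s ^ (p - 1) * y - (p - 1) * s ^ p ≤ y ^ p := by
  have h1 := one_add_mul_self_le_rpow_one_add (s := y / s - 1)
    (by linarith [div_nonneg hy hs.le]) hp
  rw [add_sub_cancel, Real.div_rpow hy hs.le, le_div_iff₀ (by positivity)] at h1
  have h2 : s ^ p = s ^ (p - 1) * s := by
    rw [Real.rpow_sub_one hs.ne']; field_simp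
  calc p * s ^ (p - 1) * y - (p - 1) * s ^ p = (1 + p * (y / s - 1)) * s ^ p := by
        rw [h2]; field_simp; ring
    _ ≤ _ := h1

/-- Hölder's inequality on the ball that contains the support of `u t`, with the measure `Φ dx` of
total mass at most `B` there: `∫ |u_t| ^ p Φ ≥ (∫ u_t Φ) ^ p / B ^ (p - 1)`. -/
lemma IsEnergySolutionWith.source_lower_bound (h : IsEnergySolutionWith m p ε f g T u v w G)
    (hm : 0 ≤ m) (hp : 1 < p) (hcone : SupportedInCone m T u) (hbT : ENNReal.ofReal b < T)
    (hΦ : IsTruncatedWave i (1 + phase m b) Φ) {B : ℝ → ℝ} (hB : ∀ t, 0 < t → 0 < B t)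
    (hB' : ∀ t, 0 < t → ∫ x in {x : E n | ‖x‖ ≤ 1 + phase m t}, Real.exp (x i) ≤ B t) :
    ∀ᵐ t, t ∈ Ioc 0 b → 0 ≤ moment Φ (v t) →
      moment Φ (v t) ^ p * B t ^ (-(p - 1)) ≤ sourceMoment p Φ w t := by
  have h1 := (ae_restrict_iff' measurableSet_Ioc).1 (h.integrable_source hbT hΦ).prod_right_ae
  filter_upwards [h1, (ae_restrict_iff' (timeIoo_measurable T)).1 h.rep_v] with t ht1 ht2 htb hF
  have hint := ht1 htb
  have hrep := ht2 (Ioc_subset_timeIoo hbT htb)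
  have ht0 : 0 < t := htb.1
  have htT : t ∈ timeIco T := mem_timeIco_of_le hbT ht0.le htb.2
  set A : Set (E n) := {x : E n | ‖x‖ ≤ 1 + phase m t} with hA
  have hAm : MeasurableSet A := (isClosed_le continuous_norm continuous_const).measurableSet
  have hv0 : v t =ᵐ[volume.restrict Aᶜ] 0 := by
    refine ae_eq_zero_of_hasDerivWithinAt ht0 htT
      (h.deriv_u.hasDerivWithinAt (sobolev_index_nonneg hm) htT) fun s hs => ?_
    rw [EventuallyEq, ae_restrict_iff' hAm.compl]
    filter_upwards [hcone s (mem_timeIco_of_le htT.2 hs.1 hs.2)] with x hx hxA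
    refine hx (lt_of_le_of_lt ?_ (not_le.1 hxA))
    have := phase_mono hm hs.1 hs.2
    simpa [phase] using this
  rw [EventuallyEq, ae_restrict_iff' hAm.compl] at hv0
  have hΦA : ∀ x ∈ A, Φ x = Real.exp (x i) := fun x hx => hΦ.eq_exp x (by
    have h2 : ‖x‖ ≤ 1 + phase m t := hx
    have := phase_mono hm ht0.le htb.2
    linarith)
  have hN0 : 0 ≤ sourceMoment p Φ w t :=
    integral_nonneg fun x => mul_nonneg (by positivity) (hΦ.nonneg x)
  have hBt := hB t ht0
  rcases hF.eq_or_lt with hF0 | hF0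
  · rw [← hF0, Real.zero_rpow (by linarith), zero_mul]
    exact hN0
  set s := moment Φ (v t) / B t with hs
  have hs0 : 0 < s := by positivity
  have hFA : ∫ x in A, v t x * Φ x = moment Φ (v t) := by
    rw [moment]
    refine setIntegral_eq_integral_of_ae_compl_eq_zero ?_
    filter_upwards [hv0] with x hx hxA
    simp [hx hxA]
  have hΦi : Integrable Φ := hΦ.smooth.continuous.integrable_of_hasCompactSupport hΦ.compact
  have hΦB : ∫ x in A, Φ x ≤ B t := by
    rw [setIntegral_congr_fun hAm hΦA]
    exact hB' t ht0
  have key : p * s ^ (p - 1) * moment Φ (v t) - (p - 1) * s ^ p * ∫ x in A, Φ x ≤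
      sourceMoment p Φ w t := by
    calc p * s ^ (p - 1) * moment Φ (v t) - (p - 1) * s ^ p * ∫ x in A, Φ x
        = ∫ x in A, (p * s ^ (p - 1) * (v t x * Φ x) - (p - 1) * s ^ p * Φ x) := by
          rw [integral_sub ((hΦ.integrable_mul (v t)).integrableOn.const_mul _)
            (hΦi.integrableOn.const_mul _), integral_const_mul, integral_const_mul, hFA]
      _ ≤ ∫ x in A, |w (t, x)| ^ p * Φ x := by
          refine setIntegral_mono_ae (((hΦ.integrable_mul (v t)).integrableOn.const_mul _).sub
            (hΦi.integrableOn.const_mul _)) hint.integrableOn ?_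
          filter_upwards [hrep] with x hx
          rw [hx]
          have h3 := tangent_le_rpow hp.le hs0 (abs_nonneg (v t x))
          have h4 : p * s ^ (p - 1) * v t x ≤ p * s ^ (p - 1) * |v t x| :=
            mul_le_mul_of_nonneg_left (le_abs_self _) (by positivity)
          nlinarith [hΦ.nonneg x]
      _ ≤ ∫ x, |w (t, x)| ^ p * Φ x :=
          setIntegral_le_integral hint
            (Eventually.of_forall fun x => mul_nonneg (by positivity) (hΦ.nonneg x))
  refine le_trans ?_ key
  have h5 : (p - 1) * s ^ p * ∫ x in A, Φ x ≤ (p - 1) * s ^ p * B t :=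
    mul_le_mul_of_nonneg_left hΦB (mul_nonneg (by linarith) (by positivity))
  have h6 : s ^ p = s ^ (p - 1) * s := by
    rw [Real.rpow_sub_one hs0.ne']; field_simp
  have h7 : s * B t = moment Φ (v t) := by rw [hs]; field_simp
  have h8 : moment Φ (v t) ^ p * B t ^ (-(p - 1)) = s ^ (p - 1) * moment Φ (v t) := by
    rw [hs, Real.div_rpow hF0.le hBt.le, Real.rpow_neg hBt.le, Real.rpow_sub_one hF0.ne']
    field_simp
  rw [h8]
  have h9 : (p - 1) * s ^ p * B t = (p - 1) * (s ^ (p - 1) * moment Φ (v t)) := by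
    rw [h6, ← h7]; ring
  linarith

end EnergySolution

end Tricomi

/-! ### The Wronskian with the decaying solution -/

namespace Tricomi

variable {m : ℝ}

/-- `U` is a solution on `[0, b]` of `U'' = t ^ (2m) U + N` with derivative `F`, where the source
`N ≥ 0` is merely integrable. -/
structure IsForcedSol (m b : ℝ) (U F N : ℝ → ℝ) : Prop where
  cont_U : ContinuousOn U (Icc 0 b)
  cont_F : ContinuousOn F (Icc 0 b)
  deriv_U : ∀ t ∈ Ioo 0 b, HasDerivAt U (F t) t
  source_nonneg : ∀ t, 0 ≤ N t
  source_int : IntervalIntegrable N volume 0 b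
  eq_F : ∀ t ∈ Icc 0 b, F t = F 0 + ∫ s in (0)..t, (N s + s ^ (2 * m) * U s)

/-- The Wronskian `U' λ - U λ'` of a forced solution with the decaying solution `λ`. -/
noncomputable def wronskian (m : ℝ) (U F : ℝ → ℝ) (t : ℝ) : ℝ :=
  F t * decaySol m t - U t * decaySolDeriv m t

namespace IsForcedSol

variable {b : ℝ} {U F N : ℝ → ℝ}

lemma continuousOn_wronskian (hm : 0 ≤ m) (h : IsForcedSol m b U F N) :
    ContinuousOn (wronskian m U F) (Icc 0 b) :=
  (h.cont_F.mul ((continuousOn_decaySol hm).mono Icc_subset_Ici_self)).sub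
    (h.cont_U.mul ((continuousOn_decaySolDeriv hm).mono Icc_subset_Ici_self))

lemma intervalIntegrable_source_mul (hm : 0 ≤ m) (hb : 0 < b) (h : IsForcedSol m b U F N) :
    IntervalIntegrable (fun s => N s * decaySol m s) volume 0 b := by
  refine h.source_int.mul_continuousOn ?_
  rw [uIcc_of_le hb.le]
  exact (continuousOn_decaySol hm).mono Icc_subset_Ici_self

/-- Only the source contributes to the growth of the Wronskian. -/
lemma wronskian_eq (hm : 0 ≤ m) (hb : 0 < b) (h : IsForcedSol m b U F N) {t : ℝ}
    (ht : t ∈ Icc 0 b) :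
    wronskian m U F t = wronskian m U F 0 + ∫ s in (0)..t, N s * decaySol m s := by
  have hlc : ContinuousOn (decaySol m) (Icc 0 b) :=
    (continuousOn_decaySol hm).mono Icc_subset_Ici_self
  have hl_deriv : ContinuousOn (decaySolDeriv m) (Icc 0 b) :=
    (continuousOn_decaySolDeriv hm).mono Icc_subset_Ici_self
  have hpow : ContinuousOn (fun s : ℝ => s ^ (2 * m)) (Icc 0 b) :=
    (Real.continuous_rpow_const (by positivity)).continuousOn
  -- All four factors are primitives of integrable functions.
  have hprim : ∀ {g g' : ℝ → ℝ}, ContinuousOn g (Icc 0 b) → ContinuousOn g' (Icc 0 b) →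
      (∀ s ∈ Ioo 0 b, HasDerivAt g (g' s) s) →
      ∀ s ∈ Icc 0 b, g s = g 0 + ∫ τ in (0)..s, g' τ := by
    intro g g' hg hg' hd s hs
    have hss : Icc 0 s ⊆ Icc 0 b := Icc_subset_Icc_right hs.2
    rw [intervalIntegral.integral_eq_sub_of_hasDerivAt_of_le hs.1 (hg.mono hss)
      (fun x hx => hd x ⟨hx.1, hx.2.trans_le hs.2⟩)
      ((hg'.mono hss).intervalIntegrable_of_Icc hs.1)]
    ring
  have eU := hprim h.cont_U h.cont_F h.deriv_U
  have el := hprim hlc hl_deriv fun s hs => hasDerivAt_decaySol hm hs.1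
  have el' : ∀ s ∈ Icc 0 b, decaySolDeriv m s =
      decaySolDeriv m 0 + ∫ τ in (0)..s, τ ^ (2 * m) * decaySol m τ := hprim hl_deriv (hpow.mul hlc) fun s hs => hasDerivAt_decaySolDeriv hm hs.1
  have iF : IntervalIntegrable (fun s => N s + s ^ (2 * m) * U s) volume 0 b :=
    h.source_int.add ((hpow.mul h.cont_U).intervalIntegrable_of_Icc hb.le)
  have iU : IntervalIntegrable F volume 0 b := h.cont_F.intervalIntegrable_of_Icc hb.le
  have il : IntervalIntegrable (decaySolDeriv m) volume 0 b := hl_deriv.intervalIntegrable_of_Icc hb.le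
  have il' : IntervalIntegrable (fun s => s ^ (2 * m) * decaySol m s) volume 0 b :=
    (hpow.mul hlc).intervalIntegrable_of_Icc hb.le
  have hac : ∀ {g : ℝ → ℝ} (c : ℝ), IntervalIntegrable g volume 0 b →
      AbsolutelyContinuousOnInterval (fun s => c + ∫ τ in (0)..s, g τ) 0 b := by
    intro g c hg
    exact (contDiff_const.contDiffOn.absolutelyContinuousOnInterval (f := fun _ : ℝ => c)).add
      (hg.absolutelyContinuousOnInterval_intervalIntegral (by simp))
  set W : ℝ → ℝ := fun s => (F 0 + ∫ τ in (0)..s, (N τ + τ ^ (2 * m) * U τ)) *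
      (decaySol m 0 + ∫ τ in (0)..s, decaySolDeriv m τ) -
    (U 0 + ∫ τ in (0)..s, F τ) *
      (decaySolDeriv m 0 + ∫ τ in (0)..s, τ ^ (2 * m) * decaySol m τ) with hW
  have hWeq : ∀ s ∈ Icc 0 b, W s = wronskian m U F s := by
    intro s hs
    simp only [hW, wronskian]
    rw [← h.eq_F s hs, ← el s hs, ← eU s hs, ← el' s hs]
  have hWac : AbsolutelyContinuousOnInterval W 0 b :=
    ((hac _ iF).fun_mul (hac _ il)).fun_sub ((hac _ iU).fun_mul (hac _ il'))
  have hst : uIcc 0 t ⊆ uIcc 0 b := by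
    rw [uIcc_of_le ht.1, uIcc_of_le hb.le]
    exact Icc_subset_Icc_right ht.2
  have h1 := (hWac.mono hst).integral_deriv_eq_sub
  have h2 : ∫ s in (0)..t, deriv W s = ∫ s in (0)..t, N s * decaySol m s := by
    refine intervalIntegral.integral_congr_ae ?_
    filter_upwards [iF.ae_hasDerivAt_integral, il.ae_hasDerivAt_integral,
      iU.ae_hasDerivAt_integral, il'.ae_hasDerivAt_integral] with s d1 d2 d3 d4 hs
    have hsb : s ∈ uIcc 0 b := hst (uIoc_subset_uIcc hs)
    have hsb' : s ∈ Icc 0 b := by rwa [uIcc_of_le hb.le] at hsb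
    have d := (((d1 hsb 0 (by simp)).const_add (F 0)).fun_mul
      ((d2 hsb 0 (by simp)).const_add (decaySol m 0))).fun_sub
      (((d3 hsb 0 (by simp)).const_add (U 0)).fun_mul
      ((d4 hsb 0 (by simp)).const_add (decaySolDeriv m 0)))
    rw [d.deriv, ← h.eq_F s hsb', ← el s hsb', ← eU s hsb', ← el' s hsb']
    ring
  rw [← hWeq t ht, ← hWeq 0 ⟨le_rfl, hb.le⟩, ← h2, h1]
  ring

lemma wronskian_mono (hm : 0 ≤ m) (hb : 0 < b) (h : IsForcedSol m b U F N) :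
    MonotoneOn (wronskian m U F) (Icc 0 b) := by
  intro s hs t ht hst
  rw [h.wronskian_eq hm hb hs, h.wronskian_eq hm hb ht]
  have hi := h.intervalIntegrable_source_mul hm hb
  have hsub : ∀ {x y : ℝ}, x ∈ Icc 0 b → y ∈ Icc 0 b → uIcc x y ⊆ uIcc 0 b := fun hx hy => by
    rw [uIcc_of_le hb.le]
    exact uIcc_subset_Icc hx hy
  have h0 : (0 : ℝ) ∈ Icc 0 b := ⟨le_rfl, hb.le⟩
  rw [← intervalIntegral.integral_add_adjacent_intervals (hi.mono_set (hsub h0 hs))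
    (hi.mono_set (hsub hs ht))]
  have : 0 ≤ ∫ τ in s..t, N τ * decaySol m τ :=
    intervalIntegral.integral_nonneg hst fun τ hτ =>
      mul_nonneg (h.source_nonneg τ) (decaySol_pos hm (hs.1.trans hτ.1)).le
  linarith

/-- The derivative `F = U'` is controlled from below by the Wronskian `W` times the derivative
`μ'` of the growing solution: `(U / λ)' = W / λ²` and `W` is non-decreasing, so
`U / λ ≤ U 0 / λ 0 + W ∫ λ⁻²`, and `F = W / λ + λ' (U / λ)` with `λ' < 0`. -/
lemma deriv_lower_bound (hm : 0 ≤ m) (h : IsForcedSol m b U F N) {t : ℝ} (ht0 : 0 < t)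
    (htb : t ≤ b) :
    wronskian m U F t * growSolDeriv m t + decaySolDeriv m t * (U 0 / decaySol m 0) ≤ F t := by
  have hb : 0 < b := ht0.trans_le htb
  have hss : Icc 0 t ⊆ Icc 0 b := Icc_subset_Icc_right htb
  have hl0 : ∀ s ∈ Icc 0 t, decaySol m s ≠ 0 := fun s hs => (decaySol_pos hm hs.1).ne'
  have hlc : ContinuousOn (decaySol m) (Icc 0 t) :=
    (continuousOn_decaySol hm).mono Icc_subset_Ici_self
  have hWc := (h.continuousOn_wronskian hm).mono hss
  have hic : ContinuousOn (fun s => (decaySol m s ^ 2)⁻¹) (Icc 0 t) :=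
    (continuousOn_inv_decaySol_sq hm).mono Icc_subset_Ici_self
  have h1 := intervalIntegral.integral_eq_sub_of_hasDerivAt_of_le ht0.le
    (f := fun s => U s / decaySol m s) (f' := fun s => wronskian m U F s * (decaySol m s ^ 2)⁻¹)
    ((h.cont_U.mono hss).div hlc hl0) (fun s hs => by
      refine ((h.deriv_U s ⟨hs.1, hs.2.trans_le htb⟩).div (hasDerivAt_decaySol hm hs.1)
        (hl0 s (Ioo_subset_Icc_self hs))).congr_deriv ?_
      rw [wronskian, div_eq_mul_inv])
    ((hWc.mul hic).intervalIntegrable_of_Icc ht0.le)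
  have h2 : ∫ s in (0)..t, wronskian m U F s * (decaySol m s ^ 2)⁻¹ ≤
      wronskian m U F t * invSqIntegral m t := by
    rw [invSqIntegral, ← intervalIntegral.integral_const_mul]
    refine intervalIntegral.integral_mono_on ht0.le
      ((hWc.mul hic).intervalIntegrable_of_Icc ht0.le)
      ((hic.intervalIntegrable_of_Icc ht0.le).const_mul _) fun s hs => ?_
    refine mul_le_mul_of_nonneg_right ?_ (by positivity)
    exact h.wronskian_mono hm hb (hss hs) ⟨ht0.le, htb⟩ hs.2
  have hlt := decaySol_pos hm ht0.le
  have h3 : U t / decaySol m t ≤ U 0 / decaySol m 0 + wronskian m U F t * invSqIntegral m t := by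
    linarith
  have h4 := mul_le_mul_of_nonpos_left h3 (decaySolDeriv_neg hm ht0.le).le
  have h5 : F t = wronskian m U F t * (decaySol m t)⁻¹ +
      decaySolDeriv m t * (U t / decaySol m t) := by
    rw [wronskian]; field_simp; ring
  rw [h5, growSolDeriv]
  linarith

end IsForcedSol

/-! ### Blow-up of the Wronskian -/

/-- A positive solution of `W t ≥ X₀ + ∫ k W ^ p` on `[t₀, b]` can exist only as long as
`(p - 1) ∫ k ≤ X₀ ^ (1 - p)`. -/
lemma integral_le_of_integral_inequality {p X₀ t₀ b : ℝ} (hp : 1 < p) (hX : 0 < X₀) (htb : t₀ ≤ b)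
    {k W : ℝ → ℝ} (hk : ContinuousOn k (Icc t₀ b)) (hk0 : ∀ t ∈ Icc t₀ b, 0 ≤ k t)
    (hW : ContinuousOn W (Icc t₀ b)) (hW0 : ∀ t ∈ Icc t₀ b, 0 < W t)
    (h : ∀ t ∈ Icc t₀ b, X₀ + ∫ s in t₀..t, k s * W s ^ p ≤ W t) :
    (p - 1) * ∫ s in t₀..b, k s ≤ X₀ ^ (1 - p) := by
  have hWp : ContinuousOn (fun s => k s * W s ^ p) (Icc t₀ b) :=
    hk.mul (hW.rpow_const fun s hs => Or.inl (hW0 s hs).ne')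
  set X : ℝ → ℝ := fun t => X₀ + ∫ s in t₀..t, k s * W s ^ p with hXdef
  have hprim : ∀ {g : ℝ → ℝ}, ContinuousOn g (Icc t₀ b) →
      ContinuousOn (fun t => ∫ s in t₀..t, g s) (Icc t₀ b) ∧
      ∀ t ∈ Ioo t₀ b, HasDerivAt (fun t => ∫ s in t₀..t, g s) (g t) t := by
    intro g hg
    constructor
    · have := intervalIntegral.continuousOn_primitive_interval (μ := volume) (f := g) (a := t₀)
        (b := b) (by rw [uIcc_of_le htb]; exact hg.integrableOn_Icc)
      rwa [uIcc_of_le htb] at this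
    · intro t ht
      refine intervalIntegral.integral_hasDerivAt_right
        ((hg.mono (Icc_subset_Icc_right ht.2.le)).intervalIntegrable_of_Icc ht.1.le)
        ((hg.mono Ioo_subset_Icc_self).stronglyMeasurableAtFilter isOpen_Ioo t ht)
        (hg.continuousAt (Icc_mem_nhds ht.1 ht.2))
  have hXpos : ∀ t ∈ Icc t₀ b, 0 < X t := by
    intro t ht
    have : 0 ≤ ∫ s in t₀..t, k s * W s ^ p := intervalIntegral.integral_nonneg ht.1 fun s hs => by
      have hs' : s ∈ Icc t₀ b := ⟨hs.1, hs.2.trans ht.2⟩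
      have := hW0 s hs'
      exact mul_nonneg (hk0 s hs') (by positivity)
    simp only [hXdef]
    linarith
  have hanti : AntitoneOn (fun t => X t ^ (1 - p) + (p - 1) * ∫ s in t₀..t, k s) (Icc t₀ b) := by
    refine antitoneOn_of_hasDerivWithinAt_nonpos (convex_Icc _ _)
      (f' := fun t => k t * W t ^ p * (1 - p) * X t ^ (1 - p - 1) + (p - 1) * k t) ?_ ?_ ?_
    · exact ((continuousOn_const.add (hprim hWp).1).rpow_const
        fun t ht => Or.inl (hXpos t ht).ne').add ((hprim hk).1.const_mul _)
    · intro t ht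
      rw [interior_Icc] at ht
      have d1 := (((hprim hWp).2 t ht).const_add X₀).rpow_const (p := 1 - p)
        (Or.inl (hXpos t (Ioo_subset_Icc_self ht)).ne')
      exact (d1.add (((hprim hk).2 t ht).const_mul (p - 1))).hasDerivWithinAt
    · intro t ht
      rw [interior_Icc] at ht
      have ht' := Ioo_subset_Icc_self ht
      have hXt := hXpos t ht'
      have h1 : X t ^ p ≤ W t ^ p := Real.rpow_le_rpow hXt.le (h t ht') (by linarith)
      have h2 : X t ^ (1 - p - 1) = (X t ^ p)⁻¹ := by
        rw [← Real.rpow_neg hXt.le]; ring_nf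
      have h3 : 0 < X t ^ p := by positivity
      have h4 : 1 ≤ W t ^ p * (X t ^ p)⁻¹ := by
        rw [← div_eq_mul_inv, one_le_div h3]; exact h1
      rw [h2]
      have h5 := hk0 t ht'
      nlinarith [mul_nonneg (mul_nonneg (by linarith : 0 ≤ p - 1) h5) (sub_nonneg.2 h4)]
  have h1 := hanti ⟨le_rfl, htb⟩ ⟨htb, le_rfl⟩ htb
  simp only [hXdef, intervalIntegral.integral_same, add_zero, mul_zero] at h1
  have h2 : 0 < X b ^ (1 - p) := by
    have := hXpos b ⟨htb, le_rfl⟩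
    positivity
  simp only [hXdef] at h2
  linarith

/-- The right-hand side of `setIntegral_exp_le` for `R = 1 + phase m t`: a bound for the mass of the
plane wave in the cone at time `t`. -/
noncomputable def coneMass (n : ℕ) (m t : ℝ) : ℝ :=
  2 * (4 * Real.pi) ^ (((n : ℝ) - 1) / 2) *
    ((1 + phase m t) ^ (((n : ℝ) - 1) / 2) * Real.exp (1 + phase m t))

lemma coneMass_pos (hm : 0 ≤ m) (n : ℕ) {t : ℝ} (ht : 0 ≤ t) : 0 < coneMass n m t := by
  have := phase_nonneg hm ht
  unfold coneMass
  positivity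

lemma exists_coneMass_le (hm : 0 ≤ m) {n : ℕ} (hn : 1 ≤ n) :
    ∃ C : ℝ, 0 < C ∧ ∀ t, 1 ≤ t →
      coneMass n m t ≤ C * (t ^ ((m + 1) * (((n : ℝ) - 1) / 2)) * Real.exp (phase m t)) := by
  have hn' : (0 : ℝ) ≤ ((n : ℝ) - 1) / 2 := by
    have : (1 : ℝ) ≤ n := by exact_mod_cast hn
    linarith
  refine ⟨2 * (4 * Real.pi) ^ (((n : ℝ) - 1) / 2) * (2 ^ (((n : ℝ) - 1) / 2) * Real.exp 1),
    by positivity, fun t ht => ?_⟩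
  have ht0 : 0 ≤ t := by linarith
  have h0 := phase_nonneg hm ht0
  have h1 : 1 ≤ t ^ (m + 1) := Real.one_le_rpow ht (by linarith)
  have h2 : phase m t ≤ t ^ (m + 1) := div_le_self (by positivity) (by linarith)
  have h3 : (1 + phase m t) ^ (((n : ℝ) - 1) / 2) ≤
      2 ^ (((n : ℝ) - 1) / 2) * t ^ ((m + 1) * (((n : ℝ) - 1) / 2)) := by
    rw [Real.rpow_mul ht0, ← Real.mul_rpow (by norm_num) (by positivity)]
    gcongr
    linarith
  calc coneMass n m t ≤ 2 * (4 * Real.pi) ^ (((n : ℝ) - 1) / 2) *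
        (2 ^ (((n : ℝ) - 1) / 2) * t ^ ((m + 1) * (((n : ℝ) - 1) / 2)) *
          (Real.exp 1 * Real.exp (phase m t))) := by
        rw [coneMass, Real.exp_add]
        gcongr
    _ = _ := by ring

/-- In the inequality `W' ≥ λ (μ' W / 2) ^ p / coneMass ^ (p - 1)` all exponentials cancel, which
leaves the power `t ^ (γ / 2 - 1)`. -/
lemma exists_rate (hm : 0 ≤ m) {n : ℕ} (hn : 1 ≤ n) {p : ℝ} (hp : 1 < p) :
    ∃ c : ℝ, 0 < c ∧ ∀ t, 1 ≤ t → c * t ^ (gammaT n m p / 2 - 1) ≤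
      decaySol m t * growSolDeriv m t ^ p * coneMass n m t ^ (-(p - 1)) := by
  obtain ⟨c₁, hc₁, h₁⟩ := exists_le_decaySol_mul hm
  obtain ⟨c₂, hc₂, h₂⟩ := exists_exp_le_growSolDeriv hm
  obtain ⟨C, hC, h₃⟩ := exists_coneMass_le hm hn
  refine ⟨c₁ * (c₂ / C) ^ (p - 1), by positivity, fun t ht => ?_⟩
  have ht0 : 0 < t := by linarith
  have hM := growSolDeriv_pos hm ht0.le
  have hB := coneMass_pos hm n ht0.le
  have hp1 : 0 < p - 1 := by linarith
  have h4 : c₂ / C * t ^ (m / 2 - (m + 1) * (((n : ℝ) - 1) / 2)) ≤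
      growSolDeriv m t / coneMass n m t := by
    rw [le_div_iff₀ hB, Real.rpow_sub ht0]
    calc _ ≤ c₂ / C * (t ^ (m / 2) / t ^ ((m + 1) * (((n : ℝ) - 1) / 2))) *
          (C * (t ^ ((m + 1) * (((n : ℝ) - 1) / 2)) * Real.exp (phase m t))) := by
          gcongr
          exact h₃ t ht
      _ = c₂ * (t ^ (m / 2) * Real.exp (phase m t)) := by field_simp
      _ ≤ _ := h₂ t ht
  have h5 := Real.rpow_le_rpow (by positivity) h4 hp1.le
  rw [Real.mul_rpow (by positivity) (by positivity), ← Real.rpow_mul ht0.le,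
    show (m / 2 - (m + 1) * (((n : ℝ) - 1) / 2)) * (p - 1) = gammaT n m p / 2 - 1 by
      unfold gammaT; ring] at h5
  have h6 : decaySol m t * growSolDeriv m t ^ p * coneMass n m t ^ (-(p - 1)) =
      decaySol m t * growSolDeriv m t * (growSolDeriv m t / coneMass n m t) ^ (p - 1) := by
    rw [Real.div_rpow hM.le hB.le, Real.rpow_neg hB.le, Real.rpow_sub_one hM.ne']
    field_simp
  rw [h6, mul_assoc]
  exact mul_le_mul (h₁ t ht) h5 (by positivity) ((by linarith [h₁ t ht]))

lemma tendsto_growSolDeriv (hm : 0 ≤ m) : Tendsto (growSolDeriv m) atTop atTop := by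
  obtain ⟨c, hc, h⟩ := exists_exp_le_growSolDeriv hm
  have hlim : Tendsto (fun t => c * Real.exp (phase m t)) atTop atTop :=
    (Real.tendsto_exp_atTop.comp (tendsto_phase hm)).const_mul_atTop hc
  refine tendsto_atTop_mono' _ ?_ hlim
  filter_upwards [eventually_ge_atTop 1] with t ht
  refine le_trans ?_ (h t ht)
  gcongr
  exact le_mul_of_one_le_left (Real.exp_pos _).le (Real.one_le_rpow ht (by linarith))

lemma neg_decaySolDeriv_le_const (hm : 0 ≤ m) {t : ℝ} (ht : 0 ≤ t) :
    -decaySolDeriv m t ≤ a m * decaySol m 0 := by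
  have := monotoneOn_Ici_of_hasDerivAt (continuousOn_decaySolDeriv hm)
    (fun _ ht => hasDerivAt_decaySolDeriv hm ht)
    (fun t ht => mul_nonneg (by positivity) (decaySol_pos hm ht.le).le)
    (mem_Ici.2 le_rfl) ht ht
  rw [decaySolDeriv_zero hm] at this
  linarith

/-- The lower bound for the source closes a differential inequality for the Wronskian. The starting
time `t₀` and the constant do not depend on the size `ε` of the initial values. -/
lemma exists_integral_rpow_le (hm : 0 ≤ m) {n : ℕ} (hn : 1 ≤ n) {p : ℝ} (hp : 1 < p) {cf cg : ℝ}
    (hc : 0 < a m * cf + cg) :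
    ∃ t₀ : ℝ, 1 ≤ t₀ ∧ ∃ K : ℝ, 0 < K ∧ ∀ (ε b : ℝ) (U F N : ℝ → ℝ), 0 < ε → t₀ ≤ b →
      IsForcedSol m b U F N → U 0 = ε * cf → F 0 = ε * cg →
      (∀ᵐ t, t ∈ Ioc 0 b → 0 ≤ F t → F t ^ p * coneMass n m t ^ (-(p - 1)) ≤ N t) →
      ∫ s in t₀..b, s ^ (gammaT n m p / 2 - 1) ≤ K * ε ^ (-(p - 1)) := by
  obtain ⟨c, hc0, hrate⟩ := exists_rate hm hn hp
  have hl0 := decaySol_pos hm le_rfl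
  set X := decaySol m 0 * (a m * cf + cg) with hX
  have hXpos : 0 < X := by positivity
  obtain ⟨t₀, hlarge⟩ := ((eventually_ge_atTop (1 : ℝ)).and
    ((tendsto_growSolDeriv hm).eventually_ge_atTop (2 * (a m * |cf|) / X))).exists_forall_of_atTop
  have ht₀1 : 1 ≤ t₀ := (hlarge t₀ le_rfl).1
  have ht₀ : ∀ t, t₀ ≤ t → 2 * (a m * |cf|) / X ≤ growSolDeriv m t := fun t ht => (hlarge t ht).2
  have hp1 : 0 < p - 1 := by linarith
  refine ⟨t₀, ht₀1, ((p - 1) * (c * 2⁻¹ ^ p))⁻¹ * X ^ (-(p - 1)), by positivity, ?_⟩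
  intro ε b U F N hε htb h hU0 hF0 hN
  have hb : 0 < b := by linarith
  have ht₀0 : 0 < t₀ := by linarith
  have hss : Icc t₀ b ⊆ Icc 0 b := Icc_subset_Icc_left ht₀0.le
  set W := wronskian m U F with hWdef
  have hW0 : W 0 = ε * X := by
    rw [hWdef, wronskian, hU0, hF0, decaySolDeriv_zero hm, hX]; ring
  have hWge : ∀ t ∈ Icc 0 b, ε * X ≤ W t := fun t ht => by
    rw [← hW0]; exact h.wronskian_mono hm hb ⟨le_rfl, hb.le⟩ ht ht.1
  have hWpos : ∀ t ∈ Icc 0 b, 0 < W t := fun t ht =>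
    (by positivity : 0 < ε * X).trans_le (hWge t ht)
  -- For `t ≥ t₀` the contribution of `U 0` is at most half of the main term.
  have hF : ∀ t ∈ Icc t₀ b, 2⁻¹ * (W t * growSolDeriv m t) ≤ F t := by
    intro t ht
    have ht0 : 0 < t := ht₀0.trans_le ht.1
    have h1 := h.deriv_lower_bound hm ht0 ht.2
    have h2 : ε * (2 * (a m * |cf|)) ≤ W t * growSolDeriv m t := by
      have h3 := ht₀ t ht.1
      rw [div_le_iff₀ hXpos] at h3
      calc ε * (2 * (a m * |cf|)) ≤ ε * (growSolDeriv m t * X) := by gcongr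
        _ = ε * X * growSolDeriv m t := by ring
        _ ≤ _ := mul_le_mul_of_nonneg_right (hWge t (hss ht)) (growSolDeriv_pos hm ht0.le).le
    have h4 : -(decaySolDeriv m t * (U 0 / decaySol m 0)) ≤ ε * (a m * |cf|) := by
      calc -(decaySolDeriv m t * (U 0 / decaySol m 0))
          = -decaySolDeriv m t * (ε * cf / decaySol m 0) := by rw [hU0]; ring
        _ ≤ -decaySolDeriv m t * (ε * |cf| / decaySol m 0) := by
          refine mul_le_mul_of_nonneg_left ?_ (by linarith [decaySolDeriv_neg hm ht0.le])
          gcongr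
          exact le_abs_self _
        _ ≤ a m * decaySol m 0 * (ε * |cf| / decaySol m 0) := by
          gcongr
          exact neg_decaySolDeriv_le_const hm ht0.le
        _ = _ := by field_simp
    linarith
  set k : ℝ → ℝ := fun t => c * 2⁻¹ ^ p * t ^ (gammaT n m p / 2 - 1) with hk
  have hkc : ContinuousOn k (Icc t₀ b) :=
    (continuousOn_id.rpow_const fun t ht =>
      Or.inl (ht₀0.trans_le ht.1).ne').const_mul _
  have hWc : ContinuousOn W (Icc t₀ b) := (h.continuousOn_wronskian hm).mono hss
  have hint := h.intervalIntegrable_source_mul hm hb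
  have hineq : ∀ t ∈ Icc t₀ b, ε * X + ∫ s in t₀..t, k s * W s ^ p ≤ W t := by
    intro t ht
    have hi1 : IntervalIntegrable (fun s => N s * decaySol m s) volume 0 t₀ :=
      hint.mono_set (by rw [uIcc_of_le ht₀0.le, uIcc_of_le hb.le]; exact Icc_subset_Icc_right htb)
    have hi2 : IntervalIntegrable (fun s => N s * decaySol m s) volume t₀ t :=
      hint.mono_set (by
        rw [uIcc_of_le ht.1, uIcc_of_le hb.le]; exact Icc_subset_Icc ht₀0.le ht.2)
    rw [hWdef, h.wronskian_eq hm hb (hss ht), ← hWdef, hW0,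
      ← intervalIntegral.integral_add_adjacent_intervals hi1 hi2]
    have h1 : 0 ≤ ∫ s in (0)..t₀, N s * decaySol m s :=
      intervalIntegral.integral_nonneg ht₀0.le fun s hs =>
        mul_nonneg (h.source_nonneg s) (decaySol_pos hm hs.1).le
    have h2 : ∫ s in t₀..t, k s * W s ^ p ≤ ∫ s in t₀..t, N s * decaySol m s := by
      refine intervalIntegral.integral_mono_ae_restrict ht.1 ?_ hi2 ?_
      · refine ContinuousOn.intervalIntegrable_of_Icc ht.1 ?_
        exact (hkc.mul (hWc.rpow_const fun s hs => Or.inl (hWpos s (hss hs)).ne')).mono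
          (Icc_subset_Icc_right ht.2)
      · rw [EventuallyLE, ae_restrict_iff' measurableSet_Icc]
        filter_upwards [hN] with s hs hst
        have hsb : s ∈ Icc t₀ b := ⟨hst.1, hst.2.trans ht.2⟩
        have hs0 : 0 < s := ht₀0.trans_le hst.1
        have hWs := hWpos s (hss hsb)
        have hMs := growSolDeriv_pos hm hs0.le
        have hls := decaySol_pos hm hs0.le
        have hBs := coneMass_pos hm n hs0.le
        have hFs := hF s hsb
        have hWM : 0 < 2⁻¹ * (W s * growSolDeriv m s) := by positivity
        have h3 := hs ⟨hs0, hsb.2⟩ (hWM.le.trans hFs)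
        calc k s * W s ^ p
            = c * s ^ (gammaT n m p / 2 - 1) * (2⁻¹ ^ p * W s ^ p) := by simp only [hk]; ring
          _ ≤ decaySol m s * growSolDeriv m s ^ p * coneMass n m s ^ (-(p - 1)) *
              (2⁻¹ ^ p * W s ^ p) :=
            mul_le_mul_of_nonneg_right (hrate s (ht₀1.trans hst.1)) (by positivity)
          _ = (2⁻¹ * (W s * growSolDeriv m s)) ^ p * coneMass n m s ^ (-(p - 1)) *
              decaySol m s := by
            rw [Real.mul_rpow (by norm_num) (by positivity), Real.mul_rpow hWs.le hMs.le]
            ring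
          _ ≤ F s ^ p * coneMass n m s ^ (-(p - 1)) * decaySol m s := by gcongr
          _ ≤ N s * decaySol m s := by gcongr
    linarith
  have key := integral_le_of_integral_inequality hp (by positivity : 0 < ε * X) htb hkc
    (fun t ht => by
      have : 0 < t := ht₀0.trans_le ht.1
      simp only [hk]; positivity) hWc (fun t ht => hWpos t (hss ht)) hineq
  simp only [hk] at key
  rw [intervalIntegral.integral_const_mul, ← mul_assoc, show 1 - p = -(p - 1) by ring,
    Real.mul_rpow hε.le hXpos.le] at key
  rw [mul_assoc, inv_mul_eq_div, le_div_iff₀ (by positivity)]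
  linarith

end Tricomi

/-! ### The lifespan estimates -/

namespace Tricomi

section

variable {n : ℕ} {m p ε : ℝ} {f g : L2 n} {T : ℝ≥0∞} {u v : ℝ → L2 n} {w : ℝ × E n → ℝ}
  {G : ℝ → Lp (E n) 2 (volume : Measure (E n))} {b : ℝ} {i : Fin n} {Φ : E n → ℝ}

lemma IsEnergySolutionWith.isForcedSol (h : IsEnergySolutionWith m p ε f g T u v w G)
    (hm : 0 ≤ m) (hcone : SupportedInCone m T u) (hb : 0 < b) (hbT : ENNReal.ofReal b < T)
    (hΦ : IsTruncatedWave i (1 + phase m b) Φ) :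
    IsForcedSol m b (fun t => moment Φ (u t)) (fun t => moment Φ (v t)) (sourceMoment p Φ w) := by
  have hsub : Icc 0 b ⊆ timeIco T := fun s hs => mem_timeIco_of_le hbT hs.1 hs.2
  have hs := sobolev_index_nonneg hm
  refine ⟨hΦ.continuousOn_moment ((h.cont_u.continuousOn zero_le_one).mono hsub),
    hΦ.continuousOn_moment ((h.cont_v.continuousOn hs).mono hsub), fun t ht => ?_,
    fun t => integral_nonneg fun x => mul_nonneg (by positivity) (hΦ.nonneg x),
    h.intervalIntegrable_source hb.le hbT hΦ,
    fun t ht => h.moment_eq_integral hm hcone hb hbT hΦ ht⟩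
  have h1 := hΦ.hasDerivWithinAt_moment
    ((h.deriv_u.hasDerivWithinAt hs (hsub (Ioo_subset_Icc_self ht))).mono hsub)
  exact h1.hasDerivAt (Icc_mem_nhds ht.1 ht.2)

lemma IsTruncatedWave.moment_eq {R R' : ℝ} {Φ' : E n → ℝ} (h : IsTruncatedWave i R Φ)
    (h' : IsTruncatedWave i R' Φ') (hR : 1 ≤ R) (hR' : 1 ≤ R')
    (hf : ∀ᵐ x, 1 < ‖x‖ → f x = 0) : moment Φ f = moment Φ' f := by
  refine integral_congr_ae ?_
  filter_upwards [hf] with x hx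
  by_cases h1 : 1 < ‖x‖
  · simp [hx h1]
  · rw [h.eq_exp x (by linarith), h'.eq_exp x (by linarith)]

/-- The hypotheses on the data give a positive moment of `a(m) f + g`. -/
lemma IsTruncatedWave.moment_data_pos (h : IsTruncatedWave i 1 Φ)
    (hf : ∀ᵐ x, 1 < ‖x‖ → f x = 0) (hg : ∀ᵐ x, 1 < ‖x‖ → g x = 0)
    (h_nonneg : ∀ᵐ x, 0 ≤ a m * f x + g x) (h_ne : ¬ ∀ᵐ x, a m * f x + g x = 0) :
    0 < a m * moment Φ f + moment Φ g := by
  have e : a m * moment Φ f + moment Φ g = ∫ x, (a m * f x + g x) * Φ x := by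
    rw [moment, moment, ← integral_const_mul,
      ← integral_add ((h.integrable_mul f).const_mul _) (h.integrable_mul g)]
    exact integral_congr_ae (Eventually.of_forall fun x => by ring)
  have hint : Integrable (fun x => (a m * f x + g x) * Φ x) := by
    refine (((h.integrable_mul f).const_mul (a m)).add (h.integrable_mul g)).congr
      (Eventually.of_forall fun x => ?_)
    simp only [Pi.add_apply]
    ring
  have h0 : 0 ≤ᵐ[volume] fun x => (a m * f x + g x) * Φ x := by
    filter_upwards [h_nonneg] with x hx
    exact mul_nonneg hx (h.nonneg x)
  rw [e]
  refine (integral_nonneg_of_ae h0).lt_of_ne' fun hz => h_ne ?_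
  filter_upwards [(integral_eq_zero_iff_of_nonneg_ae h0 hint).1 hz, hf, hg] with x hx hfx hgx
  by_cases h1 : 1 < ‖x‖
  · simp [hfx h1, hgx h1]
  · have h2 : Φ x ≠ 0 := by
      rw [h.eq_exp x (by linarith)]
      exact (Real.exp_pos _).ne'
    exact (mul_eq_zero.1 hx).resolve_right h2

/-- Every `b` in the existence interval satisfies `∫ t ^ (γ / 2 - 1) ≤ K ε ^ (-(p - 1))`. -/
lemma exists_integral_rpow_le_of_solution (hn : 1 ≤ n) (hm : 0 ≤ m) (hp : 1 < p)
    (hf : ∀ᵐ x, 1 < ‖x‖ → f x = 0) (hg : ∀ᵐ x, 1 < ‖x‖ → g x = 0)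
    (h_nonneg : ∀ᵐ x, 0 ≤ a m * f x + g x) (h_ne : ¬ ∀ᵐ x, a m * f x + g x = 0) :
    ∃ t₀ : ℝ, 1 ≤ t₀ ∧ ∃ K : ℝ, 0 < K ∧ ∀ (ε : ℝ) (T : ℝ≥0∞) (u : ℝ → L2 n), 0 < ε →
      IsEnergySolution m p ε f g T u → SupportedInCone m T u →
      ∀ b, t₀ ≤ b → ENNReal.ofReal b < T →
        ∫ s in t₀..b, s ^ (gammaT n m p / 2 - 1) ≤ K * ε ^ (-(p - 1)) := by
  have i : Fin n := ⟨0, hn⟩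
  obtain ⟨Φ₁, hΦ₁⟩ := exists_isTruncatedWave i zero_le_one
  obtain ⟨t₀, ht₀, K, hK, hmain⟩ := exists_integral_rpow_le hm hn hp
    (hΦ₁.moment_data_pos hf hg h_nonneg h_ne)
  refine ⟨t₀, ht₀, K, hK, ?_⟩
  rintro ε T u hε ⟨v, w, G, h⟩ hcone b htb hbT
  have hb : 0 < b := by linarith
  have hA := phase_nonneg hm hb.le
  obtain ⟨Φ, hΦ⟩ := exists_isTruncatedWave i (R := 1 + phase m b) (by linarith)
  refine hmain ε b _ _ _ hε htb (h.isForcedSol hm hcone hb hbT hΦ) ?_ ?_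
    (h.source_lower_bound hm hp hcone hbT hΦ (fun t ht => coneMass_pos hm n ht.le)
      fun t ht => setIntegral_exp_le i (by linarith [phase_nonneg hm ht.le]))
  · simp only [h.init_u]
    rw [hΦ.moment_smul, hΦ.moment_eq hΦ₁ (by linarith) le_rfl hf]
  · simp only [h.init_v]
    rw [hΦ.moment_smul, hΦ.moment_eq hΦ₁ (by linarith) le_rfl hg]

lemma gammaT_pos_of_lt (hn : 1 ≤ n) (hm : 0 ≤ m) (hp : 1 < p) (h : (p : EReal) < pT n m) :
    0 < gammaT n m p := by
  unfold pT at h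
  unfold gammaT
  split_ifs at h with h2
  · rw [EReal.coe_lt_coe_iff] at h
    have h3 : (2 : ℝ) ≤ n := by exact_mod_cast h2
    have h4 : 0 < (m + 1) * ((n : ℝ) - 1) - m := by nlinarith
    have h5 : p - 1 < 2 / ((m + 1) * ((n : ℝ) - 1) - m) := by linarith
    rw [lt_div_iff₀ h4] at h5
    linarith
  · obtain rfl : n = 1 := by omega
    have : 0 ≤ m * (p - 1) := mul_nonneg hm (by linarith)
    simp only [Nat.cast_one, sub_self, mul_zero, zero_sub]
    linarith

lemma gammaT_eq_zero_of_eq (hm : 0 ≤ m) (h : (p : EReal) = pT n m) : gammaT n m p = 0 := by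
  unfold pT at h
  unfold gammaT
  split_ifs at h with h2
  · rw [EReal.coe_eq_coe_iff] at h
    have h3 : (2 : ℝ) ≤ n := by exact_mod_cast h2
    have h4 : 0 < (m + 1) * ((n : ℝ) - 1) - m := by nlinarith
    rw [h]
    field_simp
    ring
  · exact absurd h (EReal.coe_ne_top p)

lemma lifespan_le_of_forall {X : ℝ} (h : ∀ (T : ℝ≥0∞) (u : ℝ → L2 n),
      IsEnergySolution m p ε f g T u → SupportedInCone m T u →
      ∀ b, ENNReal.ofReal b < T → b ≤ X) :
    lifespan m p ε f g ≤ ENNReal.ofReal X := by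
  refine sSup_le ?_
  rintro T ⟨-, u, hu, hcone⟩
  by_contra! hlt
  obtain ⟨b, -, hXb, hbT⟩ := ENNReal.lt_iff_exists_real_btwn.1 hlt
  exact absurd hXb (not_lt.2 (ENNReal.ofReal_le_ofReal (h T u hu hcone b hbT)))

end

/-- Solving `∫ t ^ (δ - 1) ≤ K e` for the upper limit of integration; it is used with
`e = ε ^ (-(p - 1))` and `δ = γ / 2`. -/
lemma le_of_integral_rpow_le {δ t₀ b K e : ℝ} (hδ : 0 < δ) (ht₀ : 1 ≤ t₀) (hK : 0 < K)
    (he : 1 ≤ e) (h : t₀ ≤ b → ∫ s in t₀..b, s ^ (δ - 1) ≤ K * e) :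
    b ≤ (t₀ ^ δ + δ * K) ^ (1 / δ) * e ^ (1 / δ) := by
  have h0 : 0 < t₀ := by linarith
  have key : ∀ c, 0 < c → c ^ δ ≤ (t₀ ^ δ + δ * K) * e →
      c ≤ (t₀ ^ δ + δ * K) ^ (1 / δ) * e ^ (1 / δ) := by
    intro c hc hce
    have := Real.rpow_le_rpow (by positivity) hce (by positivity : 0 ≤ 1 / δ)
    rwa [← Real.rpow_mul hc.le, mul_one_div_cancel hδ.ne', Real.rpow_one,
      Real.mul_rpow (by positivity) (by positivity)] at this
  have h1 : t₀ ^ δ ≤ t₀ ^ δ * e := le_mul_of_one_le_right (by positivity) he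
  have h2 : 0 < δ * K * e := by positivity
  rcases le_total t₀ b with hb | hb
  · have h3 := h hb
    rw [integral_rpow (Or.inl (by linarith)), sub_add_cancel, div_le_iff₀ hδ] at h3
    exact key b (by linarith) (by linarith)
  · exact hb.trans (key t₀ h0 (by linarith))

/-- The case `δ = 0` of `le_of_integral_rpow_le`. -/
lemma le_exp_of_integral_inv_le {t₀ b K e : ℝ} (ht₀ : 1 ≤ t₀) (hK : 0 < K)
    (he : 1 ≤ e) (h : t₀ ≤ b → ∫ s in t₀..b, s ^ (-1 : ℝ) ≤ K * e) :
    b ≤ Real.exp ((Real.log t₀ + K) * e) := by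
  have h0 : 0 < t₀ := by linarith
  have h1 : Real.log t₀ ≤ Real.log t₀ * e := le_mul_of_one_le_right (Real.log_nonneg ht₀) he
  have h2 : 0 < K * e := by positivity
  rcases le_total t₀ b with hb | hb
  · have h3 := h hb
    have hb0 : 0 < b := by linarith
    simp_rw [Real.rpow_neg_one] at h3
    rw [integral_inv_of_pos h0 hb0, Real.log_div hb0.ne' h0.ne'] at h3
    rw [← Real.log_le_iff_le_exp hb0]
    linarith
  · refine hb.trans ?_
    rw [← Real.log_le_iff_le_exp h0]
    linarith

end Tricomi

theorem theorem2p1 (n : ℕ) (hn : 1 ≤ n) (m : ℝ) (hm : 0 ≤ m) (p : ℝ) (hp : 1 < p)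
    (hpT : (p : EReal) ≤ Tricomi.pT n m)
    (f g : Tricomi.L2 n)
    (hf : Tricomi.InSobolev 1 f) (hg : Tricomi.InSobolev (1 - 1 / (m + 1)) g)
    (hf_supp : ∀ᵐ x : Tricomi.E n, 1 < ‖x‖ → f x = 0)
    (hg_supp : ∀ᵐ x : Tricomi.E n, 1 < ‖x‖ → g x = 0)
    (h_nonneg : ∀ᵐ x : Tricomi.E n, 0 ≤ Tricomi.a m * f x + g x)
    (h_ne : ¬ ∀ᵐ x : Tricomi.E n, Tricomi.a m * f x + g x = 0) :
    ∃ ε₀ : ℝ, 0 < ε₀ ∧ ∃ C : ℝ, 0 < C ∧ ∀ ε : ℝ, 0 < ε → ε ≤ ε₀ →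
      ((p : EReal) < Tricomi.pT n m →
        Tricomi.lifespan m p ε f g ≤
          ENNReal.ofReal (C * ε ^ (-(2 * (p - 1) / Tricomi.gammaT n m p)))) ∧
      ((p : EReal) = Tricomi.pT n m →
        Tricomi.lifespan m p ε f g ≤
          ENNReal.ofReal (Real.exp (C * ε ^ (-(p - 1))))) := by

  obtain ⟨t₀, ht₀, K, hK, hmain⟩ := Tricomi.exists_integral_rpow_le_of_solution hn hm hp
    hf_supp hg_supp h_nonneg h_ne
  have hp1 : 0 < p - 1 := by linarith
  have h0 : 0 < t₀ := by linarith
  have hlog := Real.log_nonneg ht₀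
  set δ := Tricomi.gammaT n m p / 2 with hδ
  refine ⟨1, one_pos, max ((t₀ ^ δ + δ * K) ^ (1 / δ)) (Real.log t₀ + K),
    lt_max_of_lt_right (by linarith), fun ε hε hε1 => ⟨fun hlt => ?_, fun heq => ?_⟩⟩
  · have hγ := Tricomi.gammaT_pos_of_lt hn hm hp hlt
    have he : 1 ≤ ε ^ (-(p - 1)) := Real.one_le_rpow_of_pos_of_le_one_of_nonpos hε hε1 (by linarith)
    have hexp : (ε ^ (-(p - 1))) ^ (1 / δ) =
        ε ^ (-(2 * (p - 1) / Tricomi.gammaT n m p)) := by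
      rw [← Real.rpow_mul hε.le, hδ]
      congr 1
      field_simp
    refine Tricomi.lifespan_le_of_forall fun T u hu hcone b hbT => ?_
    have h1 := Tricomi.le_of_integral_rpow_le (δ := δ) (by positivity) ht₀ hK he
      fun hb => hmain ε T u hε hu hcone b hb hbT
    rw [hexp] at h1
    exact h1.trans (mul_le_mul_of_nonneg_right (le_max_left _ _) (by positivity))
  · have hγ := Tricomi.gammaT_eq_zero_of_eq hm heq
    have he : 1 ≤ ε ^ (-(p - 1)) := Real.one_le_rpow_of_pos_of_le_one_of_nonpos hε hε1 (by linarith)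
    refine Tricomi.lifespan_le_of_forall fun T u hu hcone b hbT => ?_
    have h1 := Tricomi.le_exp_of_integral_inv_le ht₀ hK he fun hb => by
      have := hmain ε T u hε hu hcone b hb hbT
      rwa [hδ, hγ, zero_div, zero_sub] at this
    refine h1.trans (Real.exp_le_exp.2 (mul_le_mul_of_nonneg_right (le_max_right _ _) ?_))
    positivity
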